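/- **Setting.** Let $\mathcal L_A=\langle 0,\mathfrak s,+,\cdot,\leqslant\rangle$. A formula is *bounded* if each of its quantifiers is of the form $\forall x\leqslant t$ or $\exists x\leqslant t$, with a term $t$ not containing $x$. Let $\mathrm{I\Delta_0}$ be Robinson's arithmetic $\mathrm Q$ (with $x\leqslant y\leftrightarrow\exists z\,(x+z=y)$) plus induction, with parameters, for bounded formulas. For every $\mathcal L_A$-formula $\exists x\psi$ with exactly $m$ free variables let $\mathfrak f_{\exists x\psi}$ be an $m$-ary Skolem function symbol. The Skolemized form $\varphi^{\mathrm{Sk}}$ of a sentence $\varphi$ is obtained from its rectified negation normal form by replacing each existentially quantified variable $x$ of a subformula $\exists x\psi$ by $\mathfrak f_{\exists x\psi}(\overline y)$, where $\overline y$ are the free variables of $\exists x\psi$, and deleting all quantifiers. A *Skolem instance* of $\varphi$ results from $\varphi^{\mathrm{Sk}}$ by substituting closed terms for its variables; it is *available* in a set $D$ of closed terms if all terms appearing in it are in $D$. Let $\mathcal M\models\mathrm{I\Delta_0}$. Closed terms built from $0,\mathfrak s,+,\cdot$ and Skolem function symbols are understood in the sense of $\mathcal M$, that is, as elements of $\mathcal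 M$ that are codes of such terms, possibly of nonstandard length or with nonstandard Skolem symbols; terms are coded as binary words. A set or relation *exists in* $\mathcal M$ if it is bounded and definable in $\mathcal M$ by a bounded formula with parameters (in particular if it is coded in $\mathcal M$). For $j\in\mathcal M$ let $\underline j$ be the numeral with $\underline 0=0$, $\underline{j+1}=\mathfrak s(\underline j)$. Let $\log x=\min\{y: x\leqslant 2^y\}$ and $\omega_1(x)=2^{(\log x)\cdot(\log x)}$, in the sense of $\mathcal M$. For a set $\Lambda$ of closed terms of $\mathcal M$ put $\Lambda^{\langle 0\rangle}=\Lambda$, let $\Lambda^{\langle k+1\rangle}$ consist of $\Lambda^{\langle k\rangle}$ and of all $f(t_1,\ldots,t_m)$ with $t_1,\ldots,t_m\in\Lambda^{\langle k\rangle}$ and $f$ either a function symbol of $\mathcal L_A$ or a Skolem symbol $\mathfrak f_{\exists x\psi}$ such that $\exists x\psi$ has Gödel number at most $k$, and let $\Lambda^{\langle\infty\rangle}=\bigcup_{k\in\mathbb N}\Lambda^{\langle k\rangle}$. An *evaluation* $p$ on a set $D$ of closed terms assigns a truth value to the atomic sentences $t=s$ and $t\leqslant s$ with $t,s\in D$,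 such that $p[t=t]=1$ for $t\in D$ and, whenever $t,s\in D$ and $p[t=s]=1$, then $p[\varphi(t)]=p[\varphi(s)]$ for every atomic formula $\varphi(x)$, built by standardly many symbols from $x$ and parameters in $D$, for which all four sides of $\varphi(t)$ and $\varphi(s)$ are in $D$. It is an *$\mathrm{I\Delta_0}$-evaluation* on $D$ if it moreover satisfies every Skolem instance, available in $D$, of every axiom of $\mathrm{I\Delta_0}$. For an evaluation $p$ on $\Lambda^{\langle\infty\rangle}$ let $t/p$ be the class of $t$ under $t\sim s\iff p[t=s]=1$, and let $\mathfrak M(\Lambda,p)=\{t/p: t\in\Lambda^{\langle\infty\rangle}\}$ be the $\mathcal L_A$-structure with $f(t_1/p,\ldots,t_m/p)=f(t_1,\ldots,t_m)/p$ and $t/p\leqslant s/p\iff p[t\leqslant s]=1$. **Theorem.** Let $\mathcal M\models\mathrm{I\Delta_0}$, and let $\alpha\in\mathcal M$ be nonstandard and such that $\omega_1(\alpha)$ exists in $\mathcal M$. Let $\Lambda$ be a set of closed terms of $\mathcal M$ such that $\underline j$ exists and $\underline j\in\Lambda$ for all $j\leqslant\omega_1(\alpha)$ in $\mathcal M$,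 and let $p$ be an $\mathrm{I\Delta_0}$-evaluation on $\Lambda^{\langle\infty\rangle}$ that exists in $\mathcal M$ (that is, $p$ is the restriction to $\Lambda^{\langle\infty\rangle}$ of a pair of binary relations, interpreting $=$ and $\leqslant$, which exist in $\mathcal M$). Let $\varphi(x_1,\ldots,x_m)$ be a bounded $\mathcal L_A$-formula and let $i_1,\ldots,i_m\in\mathcal M$ with $i_1,\ldots,i_m\leqslant\alpha^k$ for some standard $k\in\mathbb N$. If $\mathcal M\models\varphi(i_1,\ldots,i_m)$, then $\underline{i_1},\ldots,\underline{i_m}\in\Lambda$ and $$\mathfrak M(\Lambda,p)\models\varphi(\underline{i_1}/p,\ldots,\underline{i_m}/p).$$ -/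

import Mathlib

open FirstOrder FirstOrder.Language

namespace HerbrandArith

/-! ## The language of arithmetic, its formulas, and the theory `IΔ₀` -/

/-- The function symbols `0`, `𝔰` (successor), `+`, `·`. -/
inductive ArithFunc : ℕ → Type
  | zero : ArithFunc 0
  | succ : ArithFunc 1
  | add : ArithFunc 2
  | mul : ArithFunc 2

/-- The relation symbol `≤` (besides equality). -/
inductive ArithRel : ℕ → Type
  | le : ArithRel 2

/-- The language of arithmetic `⟨0, 𝔰, +, ·, ≤⟩`. -/
def arith : FirstOrder.Language.{0, 0} := ⟨ArithFunc, ArithRel⟩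

section Terms

variable {α : Type}

def tzero : arith.Term α := Term.func (L := arith) ArithFunc.zero ![]
def tsucc (t : arith.Term α) : arith.Term α := Term.func (L := arith) ArithFunc.succ ![t]
def tadd (t s : arith.Term α) : arith.Term α := Term.func (L := arith) ArithFunc.add ![t, s]
def tmul (t s : arith.Term α) : arith.Term α := Term.func (L := arith) ArithFunc.mul ![t, s]

end Terms

/-- Formulas of arithmetic whose free variables are among `x₀, …, xₙ₋₁`. The quantifiers of
`all φ` and `ex φ` bind the variable `xₙ`. All connectives are primitive, since negation normal
forms and Skolem functions depend on the syntactic shape of a formula. -/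
inductive Fml : ℕ → Type
  | eq {n : ℕ} (t s : arith.Term (Fin n)) : Fml n
  | le {n : ℕ} (t s : arith.Term (Fin n)) : Fml n
  | neg {n : ℕ} (φ : Fml n) : Fml n
  | and {n : ℕ} (φ ψ : Fml n) : Fml n
  | or {n : ℕ} (φ ψ : Fml n) : Fml n
  | imp {n : ℕ} (φ ψ : Fml n) : Fml n
  | all {n : ℕ} (φ : Fml (n + 1)) : Fml n
  | ex {n : ℕ} (φ : Fml (n + 1)) : Fml n

/-- Tarskian satisfaction in a structure for the language of arithmetic. -/
def Fml.Realize {M : Type*} [arith.Structure M] : {n : ℕ} → Fml n → (Fin n → M) → Prop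
  | _, .eq t s, v => t.realize v = s.realize v
  | _, .le t s, v => Structure.RelMap (L := arith) ArithRel.le ![t.realize v, s.realize v]
  | _, .neg φ, v => ¬ φ.Realize v
  | _, .and φ ψ, v => φ.Realize v ∧ ψ.Realize v
  | _, .or φ ψ, v => φ.Realize v ∨ ψ.Realize v
  | _, .imp φ ψ, v => φ.Realize v → ψ.Realize v
  | _, .all φ, v => ∀ a : M, φ.Realize (Fin.snoc v a : Fin _ → M)
  | _, .ex φ, v => ∃ a : M, φ.Realize (Fin.snoc v a : Fin _ → M)

/-- A term not containing the new variable `xₙ`, seen among the terms in `x₀, …, xₙ`. -/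
def liftTerm {n : ℕ} (t : arith.Term (Fin n)) : arith.Term (Fin (n + 1)) :=
  t.relabel Fin.castSucc

/-- The variable `xₙ`, the last one of `x₀, …, xₙ`. -/
def lastVar (n : ℕ) : arith.Term (Fin (n + 1)) := Term.var (Fin.last n)

/-- Simultaneous substitution of terms for the free variables. -/
def Fml.subst : {n m : ℕ} → Fml n → (Fin n → arith.Term (Fin m)) → Fml m
  | _, _, .eq t s, σ => .eq (t.subst σ) (s.subst σ)
  | _, _, .le t s, σ => .le (t.subst σ) (s.subst σ)
  | _, _, .neg φ, σ => .neg (φ.subst σ)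
  | _, _, .and φ ψ, σ => .and (φ.subst σ) (ψ.subst σ)
  | _, _, .or φ ψ, σ => .or (φ.subst σ) (ψ.subst σ)
  | _, _, .imp φ ψ, σ => .imp (φ.subst σ) (ψ.subst σ)
  | n, m, .all φ, σ =>
      .all (φ.subst (Fin.snoc (fun i => liftTerm (σ i)) (lastVar m) : Fin (n + 1) → _))
  | n, m, .ex φ, σ =>
      .ex (φ.subst (Fin.snoc (fun i => liftTerm (σ i)) (lastVar m) : Fin (n + 1) → _))

/-- The set of (indices of) the variables that occur free in a formula. -/
def Fml.fv : {n : ℕ} → Fml n → Finset (Fin n)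
  | _, .eq t s => t.varFinset ∪ s.varFinset
  | _, .le t s => t.varFinset ∪ s.varFinset
  | _, .neg φ => φ.fv
  | _, .and φ ψ => φ.fv ∪ ψ.fv
  | _, .or φ ψ => φ.fv ∪ ψ.fv
  | _, .imp φ ψ => φ.fv ∪ ψ.fv
  | _, .all φ => Finset.univ.filter fun i => i.castSucc ∈ φ.fv
  | _, .ex φ => Finset.univ.filter fun i => i.castSucc ∈ φ.fv

/-- Bounded (`Δ₀`) formulas: every quantifier is of the form `∀ x ≤ t (…)`, read as
`∀ x (x ≤ t → …)`, or `∃ x ≤ t (…)`, read as `∃ x (x ≤ t ∧ …)`, where `x` is not in `t`. -/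
inductive Fml.IsBounded : {n : ℕ} → Fml n → Prop
  | eq {n : ℕ} (t s : arith.Term (Fin n)) : IsBounded (.eq t s)
  | le {n : ℕ} (t s : arith.Term (Fin n)) : IsBounded (.le t s)
  | neg {n : ℕ} {φ : Fml n} (h : IsBounded φ) : IsBounded (.neg φ)
  | and {n : ℕ} {φ ψ : Fml n} (h : IsBounded φ) (h₂ : IsBounded ψ) : IsBounded (.and φ ψ)
  | or {n : ℕ} {φ ψ : Fml n} (h : IsBounded φ) (h₂ : IsBounded ψ) : IsBounded (.or φ ψ)
  | imp {n : ℕ} {φ ψ : Fml n} (h : IsBounded φ) (h₂ : IsBounded ψ) : IsBounded (.imp φ ψ)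
  | ball {n : ℕ} (t : arith.Term (Fin n)) {φ : Fml (n + 1)} (h : IsBounded φ) :
      IsBounded (.all (.imp (.le (lastVar n) (liftTerm t)) φ))
  | bex {n : ℕ} (t : arith.Term (Fin n)) {φ : Fml (n + 1)} (h : IsBounded φ) :
      IsBounded (.ex (.and (.le (lastVar n) (liftTerm t)) φ))

/-- Universal closure. -/
def Fml.closure : {n : ℕ} → Fml n → Fml 0
  | 0, φ => φ
  | _ + 1, φ => Fml.closure (.all φ)

/-- The axioms `A₁, …, A₈` of Robinson arithmetic. -/
def robinson : Set (Fml 0) :=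
  let x : arith.Term (Fin 1) := Term.var 0
  let x₂ : arith.Term (Fin 2) := Term.var 0
  let y₂ : arith.Term (Fin 2) := Term.var 1
  let x₃ : arith.Term (Fin 3) := Term.var 0
  let y₃ : arith.Term (Fin 3) := Term.var 1
  let z₃ : arith.Term (Fin 3) := Term.var 2
  { .all (.neg (.eq (tsucc x) tzero)),
    .all (.all (.imp (.eq (tsucc x₂) (tsucc y₂)) (.eq x₂ y₂))),
    .all (.imp (.neg (.eq x tzero)) (.ex (.eq x₂ (tsucc y₂)))),
    .all (.all (.and
      (.imp (.le x₂ y₂) (.ex (.eq (tadd x₃ z₃) y₃)))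
      (.imp (.ex (.eq (tadd x₃ z₃) y₃)) (.le x₂ y₂)))),
    .all (.eq (tadd x tzero) x),
    .all (.all (.eq (tadd x₂ (tsucc y₂)) (tsucc (tadd x₂ y₂)))),
    .all (.eq (tmul x tzero) tzero),
    .all (.all (.eq (tmul x₂ (tsucc y₂)) (tadd (tmul x₂ y₂) x₂))) }

/-- The induction axiom `φ(0) ∧ ∀ x (φ(x) → φ(𝔰 x)) → ∀ x φ(x)`, where `x = xₙ` and
`x₀, …, xₙ₋₁` are parameters. -/
def Fml.ind {n : ℕ} (φ : Fml (n + 1)) : Fml n :=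
  .imp
    (.and (φ.subst (Fin.snoc Term.var tzero : Fin (n + 1) → _))
      (.all (.imp φ
        (φ.subst (Fin.snoc (fun i => Term.var i.castSucc) (tsucc (lastVar n)) :
          Fin (n + 1) → _)))))
    (.all φ)

/-- The theory `IΔ₀`: Robinson arithmetic and induction for bounded formulas. -/
def IDelta0 : Set (Fml 0) :=
  robinson ∪ {θ | ∃ (n : ℕ) (φ : Fml (n + 1)), φ.IsBounded ∧ θ = φ.ind.closure}

/-- `M ⊨ T`. -/
def Models (M : Type*) [arith.Structure M] (T : Set (Fml 0)) : Prop :=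
  ∀ θ ∈ T, θ.Realize (Fin.elim0 : Fin 0 → M)

/-! ## Gödel numbers (in `ℕ`): binary words in Polish notation -/

def unary (n : ℕ) : List Bool := List.replicate n true ++ [false]

def ArithFunc.word : {k : ℕ} → ArithFunc k → List Bool
  | _, .zero => [false, false]
  | _, .succ => [false, true]
  | _, .add => [true, false, false]
  | _, .mul => [true, false, true]

def termWord {n : ℕ} : arith.Term (Fin n) → List Bool
  | .var i => [true, true] ++ unary i
  | .func f ts => ArithFunc.word f ++ (List.ofFn fun i => termWord (ts i)).flatten

/-- The word of a formula; the word of a quantifier names the variable that it binds. -/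
def Fml.word : {n : ℕ} → Fml n → List Bool
  | _, .eq t s => [false, false, false] ++ termWord t ++ termWord s
  | _, .le t s => [false, false, true] ++ termWord t ++ termWord s
  | _, .neg φ => [false, true, false] ++ φ.word
  | _, .and φ ψ => [false, true, true] ++ φ.word ++ ψ.word
  | _, .or φ ψ => [true, false, false] ++ φ.word ++ ψ.word
  | _, .imp φ ψ => [true, false, true] ++ φ.word ++ ψ.word
  | n, .all φ => [true, true, false] ++ unary n ++ φ.word
  | n, .ex φ => [true, true, true] ++ unary n ++ φ.word

/-- The number whose binary expansion is a digit `1` followed by the given word. -/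
def wordCode (w : List Bool) : ℕ := w.foldl (fun a b => 2 * a + b.toNat) 1

/-- The Gödel number `⌜φ⌝`. -/
def Fml.godel {n : ℕ} (φ : Fml n) : ℕ := wordCode φ.word

/-! ## Skolemization -/

/-- Negation normal form: `nnf true φ` is that of `φ`, and `nnf false φ` that of `¬ φ`. -/
def Fml.nnf : {n : ℕ} → Bool → Fml n → Fml n
  | _, true, .eq t s => .eq t s
  | _, false, .eq t s => .neg (.eq t s)
  | _, true, .le t s => .le t s
  | _, false, .le t s => .neg (.le t s)
  | _, b, .neg φ => φ.nnf (!b)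
  | _, true, .and φ ψ => .and (φ.nnf true) (ψ.nnf true)
  | _, false, .and φ ψ => .or (φ.nnf false) (ψ.nnf false)
  | _, true, .or φ ψ => .or (φ.nnf true) (ψ.nnf true)
  | _, false, .or φ ψ => .and (φ.nnf false) (ψ.nnf false)
  | _, true, .imp φ ψ => .or (φ.nnf false) (ψ.nnf true)
  | _, false, .imp φ ψ => .and (φ.nnf true) (ψ.nnf false)
  | _, true, .all φ => .all (φ.nnf true)
  | _, false, .all φ => .ex (φ.nnf false)
  | _, true, .ex φ => .ex (φ.nnf true)
  | _, false, .ex φ => .all (φ.nnf false)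

/-- For every formula `∃ x ψ` a Skolem function symbol `𝔣_{∃ x ψ}`, whose arity is the number of
the free variables of `∃ x ψ`. -/
inductive SkFunc : ℕ → Type
  | sk {n : ℕ} (ψ : Fml (n + 1)) : SkFunc (Fml.ex ψ).fv.card

/-- The language of arithmetic with the Skolem function symbols of its formulas. -/
def arithSk : FirstOrder.Language.{0, 0} := arith.sum ⟨SkFunc, fun _ => Empty⟩

/-- The Skolem function symbol `𝔣_{∃ x ψ}` as a symbol of the extended language. -/
def skSymbol {n : ℕ} (ψ : Fml (n + 1)) : arithSk.Functions (Fml.ex ψ).fv.card :=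
  Sum.inr (SkFunc.sk ψ)

/-- A function symbol of arithmetic as a symbol of the extended language. -/
def baseSymbol {k : ℕ} (f : ArithFunc k) : arithSk.Functions k := Sum.inl f

/-- A term of arithmetic as a term of the extended language. -/
def toSk {α : Type} (t : arith.Term α) : arithSk.Term α :=
  (LHom.sumInl : arith →ᴸ arithSk).onTerm t

/-- Open (quantifier-free) formulas of the extended language. -/
inductive Open (V : Type) : Type
  | eq (t s : arithSk.Term V) : Open V
  | le (t s : arithSk.Term V) : Open V
  | neg (θ : Open V) : Open V
  | and (θ η : Open V) : Open V
  | or (θ η : Open V) : Open V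

/-- Skolemization of a formula (used only for negation normal formulas) under an assignment `σ`
of terms to its free variables. An existential quantifier `∃ x ψ` is deleted and `x` replaced by
`𝔣_{∃ x ψ}(ȳ)`, with `ȳ` the free variables of `∃ x ψ` in increasing order; a universal quantifier
is deleted, and its variable becomes a free variable of the result. Variables of the result are
named by the position `π` of their quantifier, so that different quantifiers refer to different
variables. -/
def Fml.skolem : {n : ℕ} → Fml n → (Fin n → arithSk.Term (List Bool)) → List Bool →
    Open (List Bool)
  | _, .eq t s, σ, _ => .eq ((toSk t).subst σ) ((toSk s).subst σ)
  | _, .le t s, σ, _ => .le ((toSk t).subst σ) ((toSk s).subst σ)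
  | _, .neg φ, σ, π => .neg (φ.skolem σ (π ++ [false]))
  | _, .and φ ψ, σ, π => .and (φ.skolem σ (π ++ [false])) (ψ.skolem σ (π ++ [true]))
  | _, .or φ ψ, σ, π => .or (φ.skolem σ (π ++ [false])) (ψ.skolem σ (π ++ [true]))
  | _, .imp φ ψ, σ, π =>
      .or (.neg (φ.skolem σ (π ++ [false]))) (ψ.skolem σ (π ++ [true]))
  | n, .all φ, σ, π => φ.skolem (Fin.snoc σ (Term.var π) : Fin (n + 1) → _) (π ++ [false])
  | n, .ex φ, σ, π =>
      φ.skolem (Fin.snoc σ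
        (Term.func (skSymbol φ) fun i => σ ((Fml.ex φ).fv.orderEmbOfFin rfl i)) :
          Fin (n + 1) → _) (π ++ [false])

/-- The Skolemized form `φ^Sk` of a sentence `φ`. -/
def Fml.sk (φ : Fml 0) : Open (List Bool) := (φ.nnf true).skolem Fin.elim0 []

/-- All subterms of a term, itself included. -/
def subterms {V : Type} : arithSk.Term V → Set (arithSk.Term V)
  | .var x => {.var x}
  | .func f ts => insert (.func f ts) (⋃ i, subterms (ts i))

/-- The terms that appear in an open formula. -/
def Open.terms {V : Type} : Open V → Set (arithSk.Term V)
  | .eq t s => subterms t ∪ subterms s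
  | .le t s => subterms t ∪ subterms s
  | .neg θ => θ.terms
  | .and θ η => θ.terms ∪ η.terms
  | .or θ η => θ.terms ∪ η.terms

/-! ## Arithmetic and recursion inside a model -/

section Internal

variable {M : Type*} [arith.Structure M]

def zeroM : M := Structure.funMap (L := arith) ArithFunc.zero ![]
def succM (x : M) : M := Structure.funMap (L := arith) ArithFunc.succ ![x]
def addM (x y : M) : M := Structure.funMap (L := arith) ArithFunc.add ![x, y]
def mulM (x y : M) : M := Structure.funMap (L := arith) ArithFunc.mul ![x, y]
def leM (x y : M) : Prop := Structure.RelMap (L := arith) ArithRel.le ![x, y]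

/-- The value in `M` of a standard number. -/
def stdM : ℕ → M
  | 0 => zeroM
  | n + 1 => succM (stdM n)

/-- `x ^ k` in `M`, for a standard exponent `k`. -/
def powM (x : M) : ℕ → M
  | 0 => succM zeroM
  | k + 1 => mulM (powM x k) x

/-- The sets (relations, functions) that exist in the sense of `M`: bounded sets which are
definable in `M` by a bounded formula with parameters. Under every coding of finite sets for which
membership is given by a bounded formula, all coded sets are of this kind. -/
def IsInternal {k : ℕ} (S : Set (Fin k → M)) : Prop :=
  (∃ b : M, ∀ v ∈ S, ∀ i, leM (v i) b) ∧
  ∃ (n : ℕ) (φ : Fml (k + n)) (c : Fin n → M), φ.IsBounded ∧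
    ∀ v : Fin k → M, v ∈ S ↔ φ.Realize (Fin.append v c)

/-- `x` is the `j`-th iterate `g^j(a)` in the sense of `M`: it is reached by a sequence
`a, g(a), g(g(a)), …` of length `j + 1` that exists in the sense of `M`. -/
def IsIterate (a : M) (g : M → M) (j x : M) : Prop :=
  ∃ F : M → M, IsInternal {v : Fin 2 → M | leM (v 0) j ∧ v 1 = F (v 0)} ∧
    F zeroM = a ∧ (∀ i, leM (succM i) j → F (succM i) = g (F i)) ∧ F j = x

/-- `y = exp(x) = 2 ^ x` in `M`. -/
def IsExp (x y : M) : Prop := IsIterate (succM zeroM) (fun z => addM z z) x y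

/-- `l = log x`, the least `l` with `x ≤ exp(l)`. -/
def IsLog (x l : M) : Prop :=
  (∃ e, IsExp l e ∧ leM x e) ∧ ∀ l' e, IsExp l' e → leM x e → leM l l'

/-- `w = ω₁(x) = exp((log x) · (log x))`. -/
def IsOmega1 (x w : M) : Prop := ∃ l, IsLog x l ∧ IsExp (mulM l l) w

/-! ## Codes of closed Skolem terms inside a model

A binary word is coded by the number whose binary expansion is a digit `1` followed by that word. -/

/-- `z` is a power of two: `z ≠ 0`, and every divisor of `z` is `1` or even. -/
def IsPow2 (z : M) : Prop :=
  z ≠ zeroM ∧ ∀ d e, leM d z → leM e z → mulM d e = z →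
    d = succM zeroM ∨ ∃ c, leM c d ∧ addM c c = d

/-- `P` is the largest power of two that is at most `y`; so `P = 2 ^ |w|` if `y` codes `w`. -/
def IsTop (y P : M) : Prop :=
  IsPow2 P ∧ leM P y ∧ ∀ Q, leM Q y → IsPow2 Q → leM Q P

/-- `z` codes the concatenation of the words coded by `x` and `y`. -/
def IsConc (x y z : M) : Prop :=
  ∃ P r, leM P y ∧ leM r y ∧ IsTop y P ∧ addM P r = y ∧ z = addM (mulM x P) r

open Classical in
/-- The code of the concatenation of two words. -/
noncomputable def conc (x y : M) : M := if h : ∃ z, IsConc x y z then h.choose else zeroM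

/-- `z` codes the self-delimiting word of the number `n ≥ 1`: if `n` codes the word `w`, this is
`1 ⋯ 1 0 w` with `|w|` many digits `1`. -/
def IsGamma (n z : M) : Prop :=
  ∃ P u, IsTop n P ∧ addM u (stdM 2) = mulM (stdM 4) P ∧ IsConc u n z

open Classical in
/-- The code of the self-delimiting word of the number `n ≥ 1`. -/
noncomputable def gamma (n : M) : M := if h : ∃ z, IsGamma n z then h.choose else zeroM

/-- The code of the function symbol `0`, `𝔰`, `+` or `·`. -/
def baseCode {k : ℕ} (f : ArithFunc k) : M := stdM (wordCode f.word)

/-- The code of the Skolem function symbol of arity `m` with index `n`, the Gödel number of an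
existential formula. -/
noncomputable def skCode (n m : M) : M :=
  conc (conc (stdM 7) (gamma n)) (gamma (succM m))

/-- The code in `M` of a (standard) function symbol. -/
noncomputable def symCode {k : ℕ} : arithSk.Functions k → M
  | Sum.inl f => baseCode f
  | Sum.inr (SkFunc.sk ψ) => skCode (stdM (Fml.ex ψ).godel) (stdM (Fml.ex ψ).fv.card)

/-- The code of the term `f(t₁, …, tₖ)` from the codes of `f` and of `t₁, …, tₖ`. -/
noncomputable def app {k : ℕ} (f : arithSk.Functions k) (t : Fin k → M) : M :=
  (List.ofFn t).foldl conc (symCode f)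

/-- The code of the closed term that arises from a term by substituting closed terms (in the sense
of `M`, given by their codes) for its variables. -/
noncomputable def termCode {V : Type*} (τ : V → M) : arithSk.Term V → M
  | .var x => τ x
  | .func f ts => app f fun i => termCode τ (ts i)

/-- `x` is the code of the numeral `j̲ = 𝔰 ⋯ 𝔰 0` (`j` times `𝔰`), for a possibly nonstandard
number `j` of `M`. -/
def IsNumeral (j x : M) : Prop :=
  IsIterate (app (baseSymbol .zero) ![]) (fun t => app (baseSymbol .succ) ![t]) j x

/-- `c` codes a function symbol of arity `a` in the sense of `M`. All numbers of `M` are admitted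
as indices of Skolem function symbols, in particular the Gödel numbers, in the sense of `M`,
of nonstandard formulas and of formulas that contain Skolem function symbols themselves. -/
def IsSymbol (c a : M) : Prop :=
  (∃ (k : ℕ) (f : ArithFunc k), c = baseCode f ∧ a = stdM k) ∨
  ∃ n, n ≠ zeroM ∧ c = skCode n a

/-- `x` is the code of a closed term in the sense of `M` (of possibly nonstandard length). Here
`(k, z) ∈ D` says that `z` codes a concatenation of `k` closed terms: such a word is empty, or
begins with a function symbol, whose arity many arguments and the `k - 1` remaining terms follow. -/
def IsTerm (x : M) : Prop :=
  ∃ D : Set (Fin 2 → M), IsInternal D ∧ ![succM zeroM, x] ∈ D ∧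
    ∀ k z, ![k, z] ∈ D → (k = zeroM ∧ z = succM zeroM) ∨
      ∃ k' c a w, k = succM k' ∧ IsSymbol c a ∧ IsConc c w z ∧ ![addM a k', w] ∈ D

/-! ## Evaluations and Herbrand models -/

/-- `Λ^⟨k⟩`. -/
def level (Λ : Set M) : ℕ → Set M
  | 0 => Λ
  | k + 1 => level Λ k ∪
      {x | ∃ (m : ℕ) (f : ArithFunc m) (t : Fin m → M),
        (∀ i, t i ∈ level Λ k) ∧ x = app (baseSymbol f) t} ∪
      {x | ∃ (n : ℕ) (ψ : Fml (n + 1)) (t : Fin (Fml.ex ψ).fv.card → M),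
        (Fml.ex ψ).godel ≤ k ∧ (∀ i, t i ∈ level Λ k) ∧ x = app (skSymbol ψ) t}

/-- `Λ^⟨∞⟩`, the union of the `Λ^⟨k⟩` over the standard numbers `k`. -/
def hull (Λ : Set M) : Set M := ⋃ k, level Λ k

end Internal

/-- A map from atomic sentences `t = s` and `t ≤ s` (with terms of `M`) to truth values; it is given
by its sets of true equations and true inequalities. -/
structure TermValuation (M : Type*) where
  eq : M → M → Prop
  le : M → M → Prop

section Evaluation

variable {M : Type*} [arith.Structure M]

/-- The valuation exists in the sense of `M`. -/
def TermValuation.Internal (p : TermValuation M) : Prop :=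
  IsInternal {v : Fin 2 → M | p.eq (v 0) (v 1)} ∧ IsInternal {v : Fin 2 → M | p.le (v 0) (v 1)}

/-- `p` is an evaluation on the set `D` of terms: `p[t = t] = 1` for `t` in `D`, and if
`p[t = s] = 1`, then `p[φ(t)] = p[φ(s)]` for every atomic formula `φ(x)` such that `φ(t)` and `φ(s)`
are atomic sentences about terms in `D`. Here `φ(x)` is built from the variable `x`
(written `none`) and terms in `D` as parameters. -/
structure TermValuation.IsEvaluation (p : TermValuation M) (D : Set M) : Prop where
  refl : ∀ t ∈ D, p.eq t t
  subst : ∀ t ∈ D, ∀ s ∈ D, p.eq t s → ∀ u v : arithSk.Term (Option D),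
    let at_ (w : arithSk.Term (Option D)) (r : M) : M :=
      termCode (fun o => o.elim r Subtype.val) w
    at_ u t ∈ D → at_ v t ∈ D → at_ u s ∈ D → at_ v s ∈ D →
      (p.eq (at_ u t) (at_ v t) ↔ p.eq (at_ u s) (at_ v s)) ∧
      (p.le (at_ u t) (at_ v t) ↔ p.le (at_ u s) (at_ v s))

/-- `p ⊨ θ[τ]`, for an open formula `θ` and closed terms `τ` substituted for its variables. -/
def TermValuation.Sat {V : Type} (p : TermValuation M) (τ : V → M) : Open V → Prop
  | .eq t s => p.eq (termCode τ t) (termCode τ s)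
  | .le t s => p.le (termCode τ t) (termCode τ s)
  | .neg θ => ¬ p.Sat τ θ
  | .and θ η => p.Sat τ θ ∧ p.Sat τ η
  | .or θ η => p.Sat τ θ ∨ p.Sat τ η

/-- `p` is a `T`-evaluation on `D`: an evaluation on `D` that satisfies every Skolem instance
`φ^Sk[τ]` of every `φ` in `T` which is available in `D`, that is, all terms appearing in it are
in `D`. -/
structure TermValuation.IsEvaluationOf (p : TermValuation M) (T : Set (Fml 0)) (D : Set M) : Prop where
  isEvaluation : p.IsEvaluation D
  sat : ∀ φ ∈ T, ∀ τ : List Bool → M, (∀ t ∈ φ.sk.terms, termCode τ t ∈ D) → p.Sat τ φ.sk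

/-- The equivalence relation `t ∼ s ↔ p[t = s] = 1` on `D`. -/
def TermValuation.IsEvaluation.setoid {p : TermValuation M} {D : Set M} (h : p.IsEvaluation D) :
    Setoid D where
  r t s := p.eq t s
  iseqv :=
    { refl := fun t => h.refl t t.2
      symm := fun {t s} e =>
        ((h.subst t t.2 s s.2 e (.var none) (.var (some t)) t.2 t.2 s.2 t.2).1).1 (h.refl t t.2)
      trans := fun {t s r} e₁ e₂ =>
        ((h.subst s s.2 r r.2 e₂ (.var (some t)) (.var none) t.2 s.2 t.2 r.2).1).1 e₁ }

theorem app_mem_hull {Λ : Set M} {k : ℕ} (f : ArithFunc k) (t : Fin k → M)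
    (ht : ∀ i, t i ∈ hull Λ) : app (baseSymbol f) t ∈ hull Λ := by
  have mono : Monotone (level Λ) :=
    monotone_nat_of_le_succ fun n x hx => Or.inl (Or.inl hx)
  choose l hl using fun i => Set.mem_iUnion.1 (ht i)
  refine Set.mem_iUnion.2 ⟨Finset.univ.sup l + 1, Or.inl (Or.inr ⟨k, f, t, fun i => ?_, rfl⟩)⟩
  exact mono (Finset.le_sup (f := l) (Finset.mem_univ i)) (hl i)

/-- Replacing one argument of a function symbol by an equivalent one gives an equivalent term. -/
theorem app_update_equiv {p : TermValuation M} {Λ : Set M} (h : p.IsEvaluation (hull Λ)) {k : ℕ}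
    (f : ArithFunc k) (t : Fin k → hull Λ) (i : Fin k) (s : hull Λ) (e : p.eq (t i) s) :
    p.eq (app (baseSymbol f) fun j => (t j : M))
      (app (baseSymbol f) fun j => (Function.update t i s j : M)) := by
  classical
  let c : hull Λ := ⟨app (baseSymbol f) fun j => (t j : M), app_mem_hull f _ fun j => (t j).2⟩
  let v : arithSk.Term (Option (hull Λ)) :=
    .func (baseSymbol f) fun j => .var (if j = i then none else some (t j))
  have hv : ∀ r : hull Λ, termCode (fun o => o.elim (r : M) Subtype.val) v =
      app (baseSymbol f) fun j => (Function.update t i r j : M) := by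
    intro r
    simp only [v, termCode]
    congr 1
    funext j
    by_cases hj : j = i
    · subst hj; simp
    · simp [hj]
  have hm : ∀ r : hull Λ, termCode (fun o => o.elim (r : M) Subtype.val) v ∈ hull Λ := fun r => by
    rw [hv]; exact app_mem_hull f _ fun j => (Function.update t i r j).2
  have key := (h.subst (t i) (t i).2 s s.2 e (.var (some c)) v c.2 (hm _) c.2 (hm _)).1
  simp only [hv, Function.update_eq_self] at key
  exact key.1 (h.refl c c.2)

/-- The relation `∼` is a congruence. -/
theorem app_equiv {p : TermValuation M} {Λ : Set M} (h : p.IsEvaluation (hull Λ)) {k : ℕ}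
    (f : ArithFunc k) (t s : Fin k → hull Λ) (e : ∀ i, p.eq (t i) (s i)) :
    p.eq (app (baseSymbol f) fun j => (t j : M)) (app (baseSymbol f) fun j => (s j : M)) := by
  classical
  have key : ∀ A : Finset (Fin k), p.eq (app (baseSymbol f) fun j => (t j : M))
      (app (baseSymbol f) fun j => (A.piecewise s t j : M)) := by
    intro A
    induction A using Finset.induction_on with
    | empty => simpa using h.refl _ (app_mem_hull f _ fun j => (t j).2)
    | insert a A ha ih =>
      have h1 := app_update_equiv h f (A.piecewise s t) a (s a) (by
        rw [Finset.piecewise_eq_of_notMem _ _ _ ha]; exact e a)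
      rw [← Finset.piecewise_insert] at h1
      exact h.setoid.trans'
        (x := ⟨_, app_mem_hull f _ fun j => (t j).2⟩)
        (y := ⟨_, app_mem_hull f _ fun j => (A.piecewise s t j).2⟩)
        (z := ⟨_, app_mem_hull f _ fun j => ((insert a A).piecewise s t j).2⟩) ih h1
  simpa using key Finset.univ

/-- An evaluation on `Λ^⟨∞⟩` makes it an `arith`-structure up to the congruence `∼`. -/
@[reducible]
noncomputable def prestructure {p : TermValuation M} {Λ : Set M}
    (h : p.IsEvaluation (hull Λ)) : arith.Prestructure h.setoid where
  toStructure :=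
    { funMap := fun {_} f t => ⟨app (baseSymbol f) fun i => (t i : M),
        app_mem_hull f _ fun i => (t i).2⟩
      RelMap := fun {_} r t => match r, t with
        | .le, t => p.le (t 0) (t 1) }
  fun_equiv := fun {_ f} x y e => app_equiv h f x y e
  rel_equiv := fun {_ r} x y e => by
    cases r
    have h0 := h.subst _ (x 0).2 _ (y 0).2 (e 0) (.var none) (.var (some (x 1)))
      (x 0).2 (x 1).2 (y 0).2 (x 1).2
    have h1 := h.subst _ (x 1).2 _ (y 1).2 (e 1) (.var (some (y 0))) (.var none)
      (y 0).2 (x 1).2 (y 0).2 (y 1).2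
    exact propext (h0.2.trans h1.2)

/-- The Herbrand model `𝔐(Λ, p) = {t/p | t ∈ Λ^⟨∞⟩}`. -/
def HerbrandModel {p : TermValuation M} {Λ : Set M} (h : p.IsEvaluation (hull Λ)) : Type _ :=
  Quotient h.setoid

/-- The structure on `𝔐(Λ, p)`: `f(t₁/p, …, tₖ/p) = f(t₁, …, tₖ)/p`, and `t/p ≤ s/p` if and only if
`p[t ≤ s] = 1`. -/
noncomputable instance {p : TermValuation M} {Λ : Set M} (h : p.IsEvaluation (hull Λ)) :
    arith.Structure (HerbrandModel h) :=
  letI := prestructure h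
  inferInstanceAs (arith.Structure (Quotient h.setoid))

/-- The class `t/p`. -/
def HerbrandModel.mk {p : TermValuation M} {Λ : Set M} (h : p.IsEvaluation (hull Λ)) (t : hull Λ) :
    HerbrandModel h :=
  Quotient.mk h.setoid t

end Evaluation

end HerbrandArith

open HerbrandArith

/-! The map that sends `j` to the class of its numeral embeds the cut `I` of all elements below some
standard power of `α` (`powerCut`) onto an initial segment of the Herbrand model, respecting
operations and order. A bounded formula with arguments in `I` has all its quantifiers bounded by
values of terms in `I`, so it has the same truth value on both sides (`IsCutEmbedding.realize_iff`).

Three facts produce this embedding.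

(1) Since `α` is nonstandard, its logarithm `l` exceeds every standard `k`. Hence `α ^ k ≤ 2 ^ (k l)
≤ 2 ^ (l l) = ω₁(α)` (`Models.pow_le_omega1`), and numerals are available throughout `I`.

(2) The hull is closed under all Skolem functions with standard index, so every Skolem instance with
values in it is available. If an axiom failed in the Herbrand model, counterexamples to its
universal quantifiers would assemble into an instance refuted by `p` (`exists_not_sat_skolem`). Thus
the Herbrand model satisfies `IΔ₀` (`TermValuation.IsEvaluationOf.models`).

(3) The Herbrand model is built outside `M`, but `p` and the sequence of numerals up to `ω₁(α)` have
bounded definitions in `M`. So a statement such as `p[x̲ + y̲ = z̲] = 1` with `z = x + y` is open to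
bounded induction on `y` in `M`, whose inductive step is a recursion equation of `Q` in the Herbrand
model. The image is an initial segment for the same reason: if `c ≤ a̲` differed from all `j̲` with
`j ≤ a`, induction on `j` would give `j̲ ≤ c` up to `j = a`, whence `c = a̲`
(`isCutEmbedding_numerals`).

The calculus of `BddDef` and `BddFn` supports (3): concatenation of codes has a bounded graph and a
polynomial majorant, so term formation may occur inside bounded formulas. -/

namespace HerbrandArith

/-! ## Semantics of substitution and closure -/

section Semantics

variable {M : Type*} [arith.Structure M]

@[simp] theorem realize_tzero {α : Type} (v : α → M) : (tzero : arith.Term α).realize v = zeroM := by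
  refine congrArg (Structure.funMap (L := arith) ArithFunc.zero) ?_
  funext i
  exact i.elim0

@[simp] theorem realize_tsucc {α : Type} (v : α → M) (t : arith.Term α) :
    (tsucc t).realize v = succM (t.realize v) := by
  refine congrArg (Structure.funMap (L := arith) ArithFunc.succ) ?_
  funext i
  fin_cases i; rfl

@[simp] theorem realize_tadd {α : Type} (v : α → M) (t s : arith.Term α) :
    (tadd t s).realize v = addM (t.realize v) (s.realize v) := by
  refine congrArg (Structure.funMap (L := arith) ArithFunc.add) ?_
  funext i
  fin_cases i <;> rfl

@[simp] theorem realize_tmul {α : Type} (v : α → M) (t s : arith.Term α) :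
    (tmul t s).realize v = mulM (t.realize v) (s.realize v) := by
  refine congrArg (Structure.funMap (L := arith) ArithFunc.mul) ?_
  funext i
  fin_cases i <;> rfl

@[simp] theorem realize_lastVar {n : ℕ} (v : Fin n → M) (a : M) :
    (lastVar n).realize (Fin.snoc v a : Fin (n + 1) → M) = a := by
  simp [lastVar]

@[simp] theorem realize_liftTerm {n : ℕ} (t : arith.Term (Fin n)) (v : Fin n → M) (a : M) :
    (liftTerm t).realize (Fin.snoc v a : Fin (n + 1) → M) = t.realize v := by
  simp only [liftTerm, Term.realize_relabel]
  congr 1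
  funext i
  simp

theorem realize_snoc_lift {n m : ℕ} (σ : Fin n → arith.Term (Fin m)) (v : Fin m → M) (a : M) :
    (fun i => ((Fin.snoc (fun i => liftTerm (σ i)) (lastVar m) : Fin (n + 1) → _) i).realize
      (Fin.snoc v a : Fin (m + 1) → M)) =
    (Fin.snoc (fun i => (σ i).realize v) a : Fin (n + 1) → M) := by
  funext i
  refine Fin.lastCases ?_ (fun i => ?_) i <;> simp

theorem Fml.realize_subst {n : ℕ} (φ : Fml n) : ∀ {m : ℕ} (σ : Fin n → arith.Term (Fin m))
    (v : Fin m → M), (φ.subst σ).Realize v ↔ φ.Realize fun i => (σ i).realize v := by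
  induction φ with
  | eq t s => intro m σ v; simp [Fml.subst, Fml.Realize]
  | le t s => intro m σ v; simp [Fml.subst, Fml.Realize]
  | neg φ ih => intro m σ v; simp [Fml.subst, Fml.Realize, ih]
  | and φ ψ ih ih' => intro m σ v; simp [Fml.subst, Fml.Realize, ih, ih']
  | or φ ψ ih ih' => intro m σ v; simp [Fml.subst, Fml.Realize, ih, ih']
  | imp φ ψ ih ih' => intro m σ v; simp [Fml.subst, Fml.Realize, ih, ih']
  | all φ ih => intro m σ v; simp only [Fml.subst, Fml.Realize, ih, realize_snoc_lift]
  | ex φ ih => intro m σ v; simp only [Fml.subst, Fml.Realize, ih, realize_snoc_lift]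

theorem liftTerm_subst {n m : ℕ} (t : arith.Term (Fin n)) (σ : Fin n → arith.Term (Fin m)) :
    (liftTerm t).subst (Fin.snoc (fun i => liftTerm (σ i)) (lastVar m) : Fin (n + 1) → _) =
      liftTerm (t.subst σ) := by
  induction t with
  | var i => simp [liftTerm, Term.relabel, Term.subst]
  | func f ts ih =>
    simp only [liftTerm, Term.relabel, Term.subst] at ih ⊢
    congr 1
    funext i
    exact ih i

theorem lastVar_subst {n m : ℕ} (σ : Fin n → arith.Term (Fin m)) :
    (lastVar n).subst (Fin.snoc (fun i => liftTerm (σ i)) (lastVar m) : Fin (n + 1) → _) =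
      lastVar m := by
  simp [lastVar, Term.subst]

theorem Fml.IsBounded.subst {n : ℕ} {φ : Fml n} (h : φ.IsBounded) :
    ∀ {m : ℕ} (σ : Fin n → arith.Term (Fin m)), (φ.subst σ).IsBounded := by
  induction h with
  | eq t s => intro m σ; exact .eq _ _
  | le t s => intro m σ; exact .le _ _
  | neg _ ih => intro m σ; exact .neg (ih σ)
  | and _ _ ih ih' => intro m σ; exact .and (ih σ) (ih' σ)
  | or _ _ ih ih' => intro m σ; exact .or (ih σ) (ih' σ)
  | imp _ _ ih ih' => intro m σ; exact .imp (ih σ) (ih' σ)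
  | ball t _ ih =>
    intro m σ
    have := IsBounded.ball (t.subst σ) (ih (Fin.snoc (fun i => liftTerm (σ i)) (lastVar m)))
    simpa only [Fml.subst, liftTerm_subst, lastVar_subst] using this
  | bex t _ ih =>
    intro m σ
    have := IsBounded.bex (t.subst σ) (ih (Fin.snoc (fun i => liftTerm (σ i)) (lastVar m)))
    simpa only [Fml.subst, liftTerm_subst, lastVar_subst] using this

theorem Fml.realize_closure : ∀ {n : ℕ} (φ : Fml n),
    φ.closure.Realize (Fin.elim0 : Fin 0 → M) ↔ ∀ v : Fin n → M, φ.Realize v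
  | 0, φ => by
    simp only [Fml.closure]
    exact ⟨fun h v => by rwa [Subsingleton.elim v Fin.elim0], fun h => h _⟩
  | n + 1, φ => by
    rw [Fml.closure, Fml.realize_closure]
    exact ⟨fun h v => by simpa using h (Fin.init v) (v (Fin.last n)), fun h v a => h _⟩

theorem Fml.realize_ind {n : ℕ} (φ : Fml (n + 1)) (v : Fin n → M) :
    φ.ind.Realize v ↔ (φ.Realize (Fin.snoc v zeroM : Fin (n + 1) → M) ∧
      (∀ a, φ.Realize (Fin.snoc v a : Fin (n + 1) → M) →
        φ.Realize (Fin.snoc v (succM a) : Fin (n + 1) → M)) →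
      ∀ a, φ.Realize (Fin.snoc v a : Fin (n + 1) → M)) := by
  have h0 : (fun i => ((Fin.snoc Term.var tzero : Fin (n + 1) → arith.Term (Fin n)) i).realize v) =
      (Fin.snoc v zeroM : Fin (n + 1) → M) := by
    funext i
    refine Fin.lastCases ?_ (fun i => ?_) i <;> simp
  have h1 : ∀ a, (fun i => ((Fin.snoc (fun i => Term.var i.castSucc) (tsucc (lastVar n)) :
      Fin (n + 1) → arith.Term (Fin (n + 1))) i).realize (Fin.snoc v a : Fin (n + 1) → M)) =
      (Fin.snoc v (succM a) : Fin (n + 1) → M) := by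
    intro a
    funext i
    refine Fin.lastCases ?_ (fun i => ?_) i <;> simp
  simp only [Fml.ind, Fml.Realize, Fml.realize_subst, h0, h1]

end Semantics

/-! ## Predicates and functions definable by bounded formulas with parameters -/

section Definability

variable {M : Type*} [arith.Structure M] {n : ℕ}

/-- `f` is given by a term with parameters. -/
def PolyFn (f : (Fin n → M) → M) : Prop :=
  ∃ (N : ℕ) (c : Fin N → M) (t : arith.Term (Fin (N + n))),
    ∀ v, f v = t.realize (Fin.append c v)

/-- `P` is given by a bounded formula with parameters. -/
def BddDef (P : (Fin n → M) → Prop) : Prop :=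
  ∃ (N : ℕ) (c : Fin N → M) (φ : Fml (N + n)), φ.IsBounded ∧
    ∀ v, P v ↔ φ.Realize (Fin.append c v)

/-- `f` has a bounded graph and is majorized by a term. -/
def BddFn (f : (Fin n → M) → M) : Prop :=
  BddDef (fun w : Fin (n + 1) → M => w (Fin.last n) = f (Fin.init w)) ∧
    ∃ g : (Fin n → M) → M, PolyFn g ∧ ∀ v, leM (f v) (g v)

/-- Together with `weakenRight`, lets two formulas or terms with different parameter tuples share
the concatenated tuple. -/
def weakenLeft (N₁ N₂ n : ℕ) : Fin (N₁ + n) → Fin (N₁ + N₂ + n) :=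
  Fin.addCases (fun i => Fin.castAdd n (Fin.castAdd N₂ i)) (fun j => Fin.natAdd _ j)

def weakenRight (N₁ N₂ n : ℕ) : Fin (N₂ + n) → Fin (N₁ + N₂ + n) :=
  Fin.addCases (fun i => Fin.castAdd n (Fin.natAdd N₁ i)) (fun j => Fin.natAdd _ j)

theorem append_comp_weakenLeft {α : Type*} {N₁ N₂ : ℕ} (c : Fin N₁ → α)
    (d : Fin N₂ → α) (v : Fin n → α) :
    Fin.append (Fin.append c d) v ∘ weakenLeft N₁ N₂ n = Fin.append c v := by
  funext i
  refine Fin.addCases (fun i => ?_) (fun i => ?_) i <;> simp [weakenLeft]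

theorem append_comp_weakenRight {α : Type*} {N₁ N₂ : ℕ} (c : Fin N₁ → α)
    (d : Fin N₂ → α) (v : Fin n → α) :
    Fin.append (Fin.append c d) v ∘ weakenRight N₁ N₂ n = Fin.append d v := by
  funext i
  refine Fin.addCases (fun i => ?_) (fun i => ?_) i <;> simp [weakenRight]

theorem PolyFn.common {f g : (Fin n → M) → M} (hf : PolyFn f) (hg : PolyFn g) :
    ∃ (N : ℕ) (c : Fin N → M) (t s : arith.Term (Fin (N + n))),
      (∀ v, f v = t.realize (Fin.append c v)) ∧ ∀ v, g v = s.realize (Fin.append c v) := by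
  obtain ⟨N₁, c, t, ht⟩ := hf
  obtain ⟨N₂, d, s, hs⟩ := hg
  refine ⟨N₁ + N₂, Fin.append c d, t.relabel (weakenLeft N₁ N₂ n),
    s.relabel (weakenRight N₁ N₂ n), fun v => ?_, fun v => ?_⟩
  · rw [ht, Term.realize_relabel, append_comp_weakenLeft]
  · rw [hs, Term.realize_relabel, append_comp_weakenRight]

theorem BddDef.common {P Q : (Fin n → M) → Prop} (hP : BddDef P) (hQ : BddDef Q) :
    ∃ (N : ℕ) (c : Fin N → M) (φ ψ : Fml (N + n)), φ.IsBounded ∧ ψ.IsBounded ∧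
      (∀ v, P v ↔ φ.Realize (Fin.append c v)) ∧ ∀ v, Q v ↔ ψ.Realize (Fin.append c v) := by
  obtain ⟨N₁, c, φ, hφ, h⟩ := hP
  obtain ⟨N₂, d, ψ, hψ, h'⟩ := hQ
  refine ⟨N₁ + N₂, Fin.append c d, φ.subst fun i => .var (weakenLeft N₁ N₂ n i),
    ψ.subst fun i => .var (weakenRight N₁ N₂ n i), hφ.subst _, hψ.subst _,
    fun v => ?_, fun v => ?_⟩
  · rw [h, Fml.realize_subst, ← append_comp_weakenLeft c d v]; rfl
  · rw [h', Fml.realize_subst, ← append_comp_weakenRight c d v]; rfl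

theorem PolyFn.var (i : Fin n) : PolyFn (fun v : Fin n → M => v i) :=
  ⟨0, Fin.elim0, .var (Fin.natAdd 0 i), fun v => by simp⟩

theorem PolyFn.const (a : M) : PolyFn (fun _ : Fin n → M => a) :=
  ⟨1, fun _ => a, .var (Fin.castAdd n 0), fun v => by simp⟩

theorem PolyFn.succ {f : (Fin n → M) → M} (hf : PolyFn f) : PolyFn fun v => succM (f v) := by
  obtain ⟨N, c, t, ht⟩ := hf
  exact ⟨N, c, tsucc t, fun v => by simp [ht]⟩

theorem PolyFn.add {f g : (Fin n → M) → M} (hf : PolyFn f) (hg : PolyFn g) :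
    PolyFn fun v => addM (f v) (g v) := by
  obtain ⟨N, c, t, s, ht, hs⟩ := hf.common hg
  exact ⟨N, c, tadd t s, fun v => by simp [ht, hs]⟩

theorem PolyFn.mul {f g : (Fin n → M) → M} (hf : PolyFn f) (hg : PolyFn g) :
    PolyFn fun v => mulM (f v) (g v) := by
  obtain ⟨N, c, t, s, ht, hs⟩ := hf.common hg
  exact ⟨N, c, tmul t s, fun v => by simp [ht, hs]⟩

theorem PolyFn.eq {f g : (Fin n → M) → M} (hf : PolyFn f) (hg : PolyFn g) :
    BddDef fun v => f v = g v := by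
  obtain ⟨N, c, t, s, ht, hs⟩ := hf.common hg
  exact ⟨N, c, .eq t s, .eq _ _, fun v => by simp [ht, hs, Fml.Realize]⟩

theorem PolyFn.le {f g : (Fin n → M) → M} (hf : PolyFn f) (hg : PolyFn g) :
    BddDef fun v => leM (f v) (g v) := by
  obtain ⟨N, c, t, s, ht, hs⟩ := hf.common hg
  exact ⟨N, c, .le t s, .le _ _, fun v => by simp [ht, hs, Fml.Realize, leM]⟩

theorem BddDef.not {P : (Fin n → M) → Prop} (hP : BddDef P) : BddDef fun v => ¬ P v := by
  obtain ⟨N, c, φ, hφ, h⟩ := hP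
  exact ⟨N, c, .neg φ, .neg hφ, fun v => by simp [h, Fml.Realize]⟩

theorem BddDef.and {P Q : (Fin n → M) → Prop} (hP : BddDef P) (hQ : BddDef Q) :
    BddDef fun v => P v ∧ Q v := by
  obtain ⟨N, c, φ, ψ, hφ, hψ, h, h'⟩ := hP.common hQ
  exact ⟨N, c, .and φ ψ, .and hφ hψ, fun v => by simp [h, h', Fml.Realize]⟩

theorem BddDef.or {P Q : (Fin n → M) → Prop} (hP : BddDef P) (hQ : BddDef Q) :
    BddDef fun v => P v ∨ Q v := by
  obtain ⟨N, c, φ, ψ, hφ, hψ, h, h'⟩ := hP.common hQ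
  exact ⟨N, c, .or φ ψ, .or hφ hψ, fun v => by simp [h, h', Fml.Realize]⟩

theorem BddDef.imp {P Q : (Fin n → M) → Prop} (hP : BddDef P) (hQ : BddDef Q) :
    BddDef fun v => P v → Q v := by
  obtain ⟨N, c, φ, ψ, hφ, hψ, h, h'⟩ := hP.common hQ
  exact ⟨N, c, .imp φ ψ, .imp hφ hψ, fun v => by simp [h, h', Fml.Realize]⟩

/-- Substitution of terms with parameters for the variables. -/
theorem BddDef.substPoly {m : ℕ} {P : (Fin m → M) → Prop} (hP : BddDef P)
    (f : Fin m → (Fin n → M) → M) (hf : ∀ i, PolyFn (f i)) :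
    BddDef fun v => P fun i => f i v := by
  -- The `m` functions bring separate parameter tuples; induction on `m` merges them into one.
  have key : ∃ (N : ℕ) (c : Fin N → M) (t : Fin m → arith.Term (Fin (N + n))),
      ∀ i v, f i v = (t i).realize (Fin.append c v) := by
    clear hP P
    induction m with
    | zero => exact ⟨0, Fin.elim0, fun i => i.elim0, fun i => i.elim0⟩
    | succ m ih =>
      obtain ⟨N₁, c, t, ht⟩ := ih (fun i => f i.castSucc) fun i => hf _
      obtain ⟨N₂, d, s, hs⟩ := hf (Fin.last m)
      refine ⟨N₁ + N₂, Fin.append c d, Fin.snoc (fun i => (t i).relabel (weakenLeft N₁ N₂ n))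
        (s.relabel (weakenRight N₁ N₂ n)), fun i v => ?_⟩
      refine Fin.lastCases ?_ (fun i => ?_) i
      · simp only [Fin.snoc_last, hs, Term.realize_relabel, append_comp_weakenRight]
      · simp only [Fin.snoc_castSucc, ht, Term.realize_relabel, append_comp_weakenLeft]
  obtain ⟨N₁, c, φ, hφ, h⟩ := hP
  obtain ⟨N₂, d, t, ht⟩ := key
  refine ⟨N₁ + N₂, Fin.append c d, φ.subst (Fin.addCases
    (fun i => .var (Fin.castAdd n (Fin.castAdd N₂ i)))
    (fun j => (t j).relabel (weakenRight N₁ N₂ n))), hφ.subst _, fun v => ?_⟩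
  refine (h _).trans (Iff.trans (iff_of_eq (congrArg φ.Realize ?_))
    (Fml.realize_subst _ _ _).symm)
  funext i
  refine Fin.addCases (fun i => ?_) (fun i => ?_) i
  · simp
  · simp only [Fin.append_right, Fin.addCases_right, ht, Term.realize_relabel,
      append_comp_weakenRight]

/-- Parameters stand before the variables, so the variable bound by a quantifier, always the last
one, extends `v` and leaves the parameters in place. -/
theorem snoc_append {α : Type*} {N : ℕ} (c : Fin N → α) (v : Fin n → α) (a : α) :
    (Fin.snoc (Fin.append c v) a : Fin (N + n + 1) → α) =
      Fin.append c (Fin.snoc v a : Fin (n + 1) → α) :=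
  (Fin.append_snoc c v a).symm

theorem BddDef.ex {f : (Fin n → M) → M} {P : (Fin n → M) → M → Prop} (hf : PolyFn f)
    (hP : BddDef fun w : Fin (n + 1) → M => P (Fin.init w) (w (Fin.last n))) :
    BddDef fun v => ∃ a, leM a (f v) ∧ P v a := by
  obtain ⟨N, c, φ, hφ, h⟩ := hP
  obtain ⟨N', d, t, ht⟩ := hf
  refine ⟨N + N', Fin.append c d, .ex (.and (.le (lastVar _)
    (liftTerm (t.relabel (weakenRight N N' n))))
    (φ.subst fun i => .var (weakenLeft N N' (n + 1) i))), .bex _ (hφ.subst _), fun v => ?_⟩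
  simp only [Fml.Realize, realize_lastVar, realize_liftTerm, Term.realize_relabel,
    append_comp_weakenRight, ← ht, Fml.realize_subst]
  simp only [snoc_append, Term.realize_var]
  refine exists_congr fun a => and_congr Iff.rfl ?_
  have := h (Fin.snoc v a)
  beta_reduce at this
  rw [Fin.init_snoc, Fin.snoc_last, ← append_comp_weakenLeft c d] at this
  exact this

theorem BddDef.all {f : (Fin n → M) → M} {P : (Fin n → M) → M → Prop} (hf : PolyFn f)
    (hP : BddDef fun w : Fin (n + 1) → M => P (Fin.init w) (w (Fin.last n))) :
    BddDef fun v => ∀ a, leM a (f v) → P v a := by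
  have := (BddDef.ex (P := fun v a => ¬ P v a) hf hP.not).not
  simpa only [not_exists, not_and, not_not] using this

theorem BddDef.congr {P Q : (Fin n → M) → Prop} (hP : BddDef P) (h : ∀ v, Q v ↔ P v) :
    BddDef Q := by
  have : Q = P := funext fun v => propext (h v)
  rwa [this]

/-- `IsInternal` lists the parameters after the variables and `BddDef` before them, whence the
exchange of blocks. -/
theorem IsInternal.bddDef {S : Set (Fin n → M)} (h : IsInternal S) : BddDef fun v => v ∈ S := by
  obtain ⟨-, N, φ, c, hφ, h⟩ := h
  refine ⟨N, c, φ.subst (Fin.addCases (fun i => .var (Fin.natAdd N i))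
    (fun j => .var (Fin.castAdd n j))), hφ.subst _, fun v => ?_⟩
  refine (h _).trans (Iff.trans (iff_of_eq (congrArg φ.Realize ?_))
    (Fml.realize_subst _ _ _).symm)
  funext i
  refine Fin.addCases (fun i => ?_) (fun i => ?_) i <;> simp

end Definability

/-! ## Elementary arithmetic in models of `IΔ₀` -/

section Algebra

variable {M : Type*} [arith.Structure M]

/-- The parameters of `P` instantiate the universal closure of the induction axiom. Every later
induction along the elements of a model passes through here, and the work lies in checking `BddDef`.
-/
theorem Models.induction (hM : Models M IDelta0) {P : M → Prop}
    (hP : BddDef fun v : Fin 1 → M => P (v 0)) (h0 : P zeroM) (hs : ∀ x, P x → P (succM x))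
    (x : M) : P x := by
  obtain ⟨N, c, φ, hφ, h⟩ := hP
  have key := hM _ (Or.inr ⟨N, φ, hφ, rfl⟩)
  rw [Fml.realize_closure] at key
  have hr : ∀ a, φ.Realize (Fin.snoc c a : Fin (N + 1) → M) ↔ P a := fun a => by
    rw [← Fin.append_right_eq_snoc c fun _ => a]
    exact (h fun _ => a).symm
  have := (Fml.realize_ind φ c).1 (key c)
  simp only [hr] at this
  exact this ⟨h0, hs⟩ x

theorem Models.succ_ne_zero (hM : Models M IDelta0) (x : M) : succM x ≠ zeroM := by
  have h : robinson _ := (by simp only [robinson]; exact Or.inl rfl)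
  simpa [Fml.Realize, Fin.snoc] using hM _ (Or.inl h) x

theorem Models.succ_inj (hM : Models M IDelta0) {x y : M} (e : succM x = succM y) : x = y := by
  have h : robinson _ := (by simp only [robinson]; exact Or.inr (Or.inl rfl))
  have := hM _ (Or.inl h) x y
  simp [Fml.Realize, Fin.snoc] at this
  exact this e

theorem Models.exists_pred (hM : Models M IDelta0) {x : M} (hx : x ≠ zeroM) :
    ∃ y, x = succM y := by
  have h : robinson _ := (by simp only [robinson]; exact Or.inr (Or.inr (Or.inl rfl)))
  have := hM _ (Or.inl h) x
  simp [Fml.Realize, Fin.snoc] at this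
  exact this hx

theorem Models.le_iff (hM : Models M IDelta0) {x y : M} : leM x y ↔ ∃ z, addM x z = y := by
  have h : robinson _ := (by simp only [robinson]; exact Or.inr (Or.inr (Or.inr (Or.inl rfl))))
  have := hM _ (Or.inl h) x y
  simp [Fml.Realize, Fin.snoc] at this
  exact ⟨this.1, fun ⟨z, hz⟩ => this.2 z hz⟩

theorem Models.add_zero (hM : Models M IDelta0) (x : M) : addM x zeroM = x := by
  have h : robinson _ := (by
    simp only [robinson]; exact Or.inr (Or.inr (Or.inr (Or.inr (Or.inl rfl)))))
  simpa [Fml.Realize, Fin.snoc] using hM _ (Or.inl h) x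

theorem Models.add_succ (hM : Models M IDelta0) (x y : M) :
    addM x (succM y) = succM (addM x y) := by
  have h : robinson _ := (by
    simp only [robinson]; exact Or.inr (Or.inr (Or.inr (Or.inr (Or.inr (Or.inl rfl))))))
  simpa [Fml.Realize, Fin.snoc] using hM _ (Or.inl h) x y

theorem Models.mul_zero (hM : Models M IDelta0) (x : M) : mulM x zeroM = zeroM := by
  have h : robinson _ := (by
    simp only [robinson]; exact Or.inr (Or.inr (Or.inr (Or.inr (Or.inr (Or.inr (Or.inl rfl)))))))
  simpa [Fml.Realize, Fin.snoc] using hM _ (Or.inl h) x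

theorem Models.mul_succ (hM : Models M IDelta0) (x y : M) :
    mulM x (succM y) = addM (mulM x y) x := by
  have h : robinson _ := (by
    simp only [robinson]; exact Or.inr (Or.inr (Or.inr (Or.inr (Or.inr (Or.inr (Or.inr rfl)))))))
  simpa [Fml.Realize, Fin.snoc] using hM _ (Or.inl h) x y

theorem Models.zero_add (hM : Models M IDelta0) (x : M) : addM zeroM x = x := by
  refine hM.induction (P := fun x => addM zeroM x = x)
    (((PolyFn.const _).add (.var 0)).eq (.var 0)) (hM.add_zero _) (fun x ih => ?_) x
  rw [hM.add_succ, ih]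

theorem Models.succ_add (hM : Models M IDelta0) (x y : M) :
    addM (succM x) y = succM (addM x y) := by
  refine hM.induction (P := fun y => addM (succM x) y = succM (addM x y))
    (((PolyFn.const _).add (.var 0)).eq ((PolyFn.const _).add (.var 0)).succ) ?_
    (fun y ih => ?_) y
  · rw [hM.add_zero, hM.add_zero]
  · rw [hM.add_succ, ih, hM.add_succ]

theorem Models.add_comm (hM : Models M IDelta0) (x y : M) : addM x y = addM y x := by
  refine hM.induction (P := fun y => addM x y = addM y x)
    (((PolyFn.const _).add (.var 0)).eq ((PolyFn.var 0).add (.const _))) ?_ (fun y ih => ?_) y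
  · rw [hM.add_zero, hM.zero_add]
  · rw [hM.add_succ, ih, hM.succ_add]

theorem Models.add_assoc (hM : Models M IDelta0) (x y z : M) :
    addM (addM x y) z = addM x (addM y z) := by
  refine hM.induction (P := fun z => addM (addM x y) z = addM x (addM y z))
    (((PolyFn.const _).add (.var 0)).eq ((PolyFn.const _).add ((PolyFn.const _).add (.var 0))))
    ?_ (fun z ih => ?_) z
  · rw [hM.add_zero, hM.add_zero]
  · rw [hM.add_succ, ih, hM.add_succ, hM.add_succ]

theorem Models.zero_mul (hM : Models M IDelta0) (x : M) : mulM zeroM x = zeroM := by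
  refine hM.induction (P := fun x => mulM zeroM x = zeroM)
    (((PolyFn.const _).mul (.var 0)).eq (.const _)) (hM.mul_zero _) (fun x ih => ?_) x
  rw [hM.mul_succ, ih, hM.add_zero]

theorem Models.succ_mul (hM : Models M IDelta0) (x y : M) :
    mulM (succM x) y = addM (mulM x y) y := by
  refine hM.induction (P := fun y => mulM (succM x) y = addM (mulM x y) y)
    (((PolyFn.const _).mul (.var 0)).eq (((PolyFn.const _).mul (.var 0)).add (.var 0))) ?_
    (fun y ih => ?_) y
  · rw [hM.mul_zero, hM.mul_zero, hM.add_zero]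
  · rw [hM.mul_succ, ih, hM.mul_succ, hM.add_succ, hM.add_succ, hM.add_assoc, hM.add_assoc,
      hM.add_comm y x]

theorem Models.mul_comm (hM : Models M IDelta0) (x y : M) : mulM x y = mulM y x := by
  refine hM.induction (P := fun y => mulM x y = mulM y x)
    (((PolyFn.const _).mul (.var 0)).eq ((PolyFn.var 0).mul (.const _))) ?_ (fun y ih => ?_) y
  · rw [hM.mul_zero, hM.zero_mul]
  · rw [hM.mul_succ, ih, hM.succ_mul]

theorem Models.mul_add (hM : Models M IDelta0) (x y z : M) :
    mulM x (addM y z) = addM (mulM x y) (mulM x z) := by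
  refine hM.induction (P := fun z => mulM x (addM y z) = addM (mulM x y) (mulM x z))
    (((PolyFn.const _).mul ((PolyFn.const _).add (.var 0))).eq
      ((PolyFn.const _).add ((PolyFn.const _).mul (.var 0)))) ?_ (fun z ih => ?_) z
  · rw [hM.add_zero, hM.mul_zero, hM.add_zero]
  · rw [hM.add_succ, hM.mul_succ, ih, hM.mul_succ, hM.add_assoc]

theorem Models.mul_assoc (hM : Models M IDelta0) (x y z : M) :
    mulM (mulM x y) z = mulM x (mulM y z) := by
  refine hM.induction (P := fun z => mulM (mulM x y) z = mulM x (mulM y z))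
    (((PolyFn.const _).mul (.var 0)).eq ((PolyFn.const _).mul ((PolyFn.const _).mul (.var 0))))
    ?_ (fun z ih => ?_) z
  · rw [hM.mul_zero, hM.mul_zero, hM.mul_zero]
  · rw [hM.mul_succ, ih, hM.mul_succ, hM.mul_add]

theorem Models.mul_one (hM : Models M IDelta0) (x : M) : mulM x (succM zeroM) = x := by
  rw [hM.mul_succ, hM.mul_zero, hM.zero_add]

theorem Models.add_left_cancel (hM : Models M IDelta0) {x y z : M} (e : addM x y = addM x z) :
    y = z := by
  revert e
  refine hM.induction (P := fun x => addM x y = addM x z → y = z)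
    ((((PolyFn.var 0).add (.const _)).eq ((PolyFn.var 0).add (.const _))).imp
      ((PolyFn.const _).eq (.const _))) ?_ (fun x ih e => ?_) x
  · rw [hM.zero_add, hM.zero_add]; exact id
  · rw [hM.succ_add, hM.succ_add] at e
    exact ih (hM.succ_inj e)

theorem Models.eq_zero_of_add (hM : Models M IDelta0) {x y : M} (e : addM x y = zeroM) :
    y = zeroM := by
  by_contra hy
  obtain ⟨z, rfl⟩ := hM.exists_pred hy
  rw [hM.add_succ] at e
  exact hM.succ_ne_zero _ e

theorem Models.le_refl (hM : Models M IDelta0) (x : M) : leM x x :=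
  hM.le_iff.2 ⟨_, hM.add_zero x⟩

theorem Models.le_trans (hM : Models M IDelta0) {x y z : M} (h : leM x y) (h' : leM y z) :
    leM x z := by
  obtain ⟨a, rfl⟩ := hM.le_iff.1 h
  obtain ⟨b, rfl⟩ := hM.le_iff.1 h'
  exact hM.le_iff.2 ⟨addM a b, (hM.add_assoc _ _ _).symm⟩

theorem Models.le_antisymm (hM : Models M IDelta0) {x y : M} (h : leM x y) (h' : leM y x) :
    x = y := by
  obtain ⟨a, rfl⟩ := hM.le_iff.1 h
  obtain ⟨b, hb⟩ := hM.le_iff.1 h'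
  have : addM x (addM a b) = addM x zeroM := by rw [← hM.add_assoc, hb, hM.add_zero]
  have h0 := hM.add_left_cancel this
  rw [hM.add_comm] at h0
  rw [hM.eq_zero_of_add h0, hM.add_zero]

theorem Models.le_total (hM : Models M IDelta0) (x y : M) : leM x y ∨ leM y x := by
  refine hM.induction (P := fun y => leM x y ∨ leM y x)
    (((PolyFn.const _).le (.var 0)).or ((PolyFn.var 0).le (.const _))) ?_ (fun y ih => ?_) y
  · exact Or.inr (hM.le_iff.2 ⟨x, hM.zero_add x⟩)
  · rcases ih with h | h
    · obtain ⟨a, rfl⟩ := hM.le_iff.1 h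
      exact Or.inl (hM.le_iff.2 ⟨succM a, hM.add_succ _ _⟩)
    · obtain ⟨a, rfl⟩ := hM.le_iff.1 h
      by_cases ha : a = zeroM
      · subst ha
        exact Or.inl (hM.le_iff.2 ⟨succM zeroM, by rw [hM.add_succ, hM.add_zero, hM.add_zero]⟩)
      · obtain ⟨b, rfl⟩ := hM.exists_pred ha
        exact Or.inr (hM.le_iff.2 ⟨b, by rw [hM.succ_add, hM.add_succ]⟩)

/-- The commutative semiring of a model of `IΔ₀`. -/
abbrev Models.commSemiring (hM : Models M IDelta0) : CommSemiring M where
  add := addM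
  zero := zeroM
  mul := mulM
  one := succM zeroM
  nsmul := @nsmulRec M ⟨zeroM⟩ ⟨addM⟩
  npow := @npowRec M ⟨succM zeroM⟩ ⟨mulM⟩
  natCast := stdM
  natCast_zero := rfl
  natCast_succ n := by
    change succM (stdM n) = addM (stdM n) (succM zeroM)
    rw [hM.add_succ, hM.add_zero]
  add_assoc := hM.add_assoc
  zero_add := hM.zero_add
  add_zero := hM.add_zero
  add_comm := hM.add_comm
  mul_assoc := hM.mul_assoc
  mul_comm := hM.mul_comm
  zero_mul := hM.zero_mul
  mul_zero := hM.mul_zero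
  one_mul x := by change mulM (succM zeroM) x = x; rw [hM.mul_comm, hM.mul_one]
  mul_one := hM.mul_one
  left_distrib := hM.mul_add
  right_distrib x y z := by
    change mulM (addM x y) z = addM (mulM x z) (mulM y z)
    rw [hM.mul_comm, hM.mul_add, hM.mul_comm z, hM.mul_comm z]

/-- The linear order of a model of `IΔ₀`. -/
noncomputable abbrev Models.linearOrder (hM : Models M IDelta0) : LinearOrder M where
  le := leM
  le_refl := hM.le_refl
  le_trans _ _ _ := hM.le_trans
  le_antisymm _ _ := hM.le_antisymm
  le_total := hM.le_total
  toDecidableLE := Classical.decRel _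

theorem Models.isStrictOrderedRing (hM : Models M IDelta0) :
    letI := hM.commSemiring
    letI := hM.linearOrder
    IsStrictOrderedRing M := by
  let _ := hM.commSemiring
  let _ := hM.linearOrder
  have add_le : ∀ a b : M, a ≤ b → ∀ c, a + c ≤ b + c := by
    intro a b h c
    obtain ⟨d, rfl⟩ := hM.le_iff.1 h
    exact hM.le_iff.2 ⟨d, by change a + c + d = a + d + c; ring⟩
  have cancel : ∀ a b c : M, a + b ≤ a + c → b ≤ c := by
    intro a b c h
    obtain ⟨d, hd⟩ := hM.le_iff.1 h
    exact hM.le_iff.2 ⟨d, hM.add_left_cancel (x := a) (by rw [← hM.add_assoc]; exact hd)⟩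
  have mul_lt : ∀ a b c : M, 0 < c → a < b → c * a < c * b := by
    intro a b c hc h
    obtain ⟨d, rfl⟩ := hM.le_iff.1 h.le
    obtain ⟨e, rfl⟩ := hM.exists_pred (x := d) (by
      rintro rfl; exact h.ne (hM.add_zero a).symm)
    obtain ⟨f, rfl⟩ := hM.exists_pred (x := c) hc.ne'
    refine lt_of_le_of_ne (hM.le_iff.2 ⟨mulM (succM f) (succM e), (hM.mul_add _ _ _).symm⟩) ?_
    intro he
    have h1 : addM (mulM (succM f) a) zeroM = addM (mulM (succM f) a) (mulM (succM f) (succM e)) := by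
      rw [hM.add_zero, ← hM.mul_add]; exact he
    have h2 := hM.add_left_cancel h1
    rw [hM.mul_succ, hM.add_succ] at h2
    exact hM.succ_ne_zero _ h2.symm
  exact {
    add_le_add_left := add_le
    le_of_add_le_add_left := cancel
    zero_le_one := hM.le_iff.2 ⟨_, hM.zero_add _⟩
    exists_pair_ne := ⟨0, 1, (hM.succ_ne_zero zeroM).symm⟩
    mul_lt_mul_of_pos_left := fun c hc a b h => mul_lt a b c hc h
    mul_lt_mul_of_pos_right := fun c hc a b h => by
      change a * c < b * c
      rw [_root_.mul_comm a, _root_.mul_comm b]; exact mul_lt a b c hc h }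

theorem Models.canonicallyOrderedAdd (hM : Models M IDelta0) :
    letI := hM.commSemiring
    letI := hM.linearOrder
    CanonicallyOrderedAdd M := by
  let _ := hM.commSemiring
  let _ := hM.linearOrder
  exact {
    exists_add_of_le := fun h => (hM.le_iff.1 h).imp fun _ e => e.symm
    le_add_self := fun a b => hM.le_iff.2 ⟨b, hM.add_comm a b⟩
    le_self_add := fun a b => hM.le_iff.2 ⟨b, rfl⟩ }

theorem Models.succ_eq_add_one (hM : Models M IDelta0) (x : M) :
    letI := hM.commSemiring
    succM x = x + 1 := by
  change succM x = addM x (succM zeroM)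
  rw [hM.add_succ, hM.add_zero]

theorem Models.powM_eq (hM : Models M IDelta0) (x : M) (k : ℕ) :
    letI := hM.commSemiring
    powM x k = x ^ k := by
  let _ := hM.commSemiring
  induction k with
  | zero => exact (pow_zero x).symm
  | succ k ih => rw [powM, ih, pow_succ]; rfl

theorem Models.lt_succ_iff (hM : Models M IDelta0) {x y : M} :
    letI := hM.linearOrder
    x < y ↔ leM (succM x) y := by
  let _ := hM.linearOrder
  let _ := hM.commSemiring
  have := hM.isStrictOrderedRing
  have := hM.canonicallyOrderedAdd
  rw [hM.succ_eq_add_one]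
  constructor
  · intro h
    obtain ⟨d, rfl⟩ := hM.le_iff.1 h.le
    obtain ⟨e, rfl⟩ := hM.exists_pred (x := d) (by
      rintro rfl; exact h.ne (hM.add_zero x).symm)
    exact hM.le_iff.2 ⟨e, by rw [hM.succ_eq_add_one]; change x + 1 + e = x + (e + 1); ring⟩
  · intro h
    exact lt_of_lt_of_le (lt_add_one x) h

end Algebra

/-! ## Composition of definable functions -/

theorem arith_term_induction {α : Type} {P : arith.Term α → Prop} (var : ∀ x, P (.var x))
    (zero : P tzero) (succ : ∀ t, P t → P (tsucc t))
    (add : ∀ t s, P t → P s → P (tadd t s)) (mul : ∀ t s, P t → P s → P (tmul t s))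
    (t : arith.Term α) : P t := by
  induction t with
  | var x => exact var x
  | func f ts ih =>
    cases f with
    | zero =>
      have : ts = ![] := Subsingleton.elim _ _
      subst this; exact zero
    | succ =>
      have : ts = ![ts 0] := by funext i; fin_cases i; rfl
      rw [this]; exact succ _ (ih 0)
    | add =>
      have : ts = ![ts 0, ts 1] := by funext i; fin_cases i <;> rfl
      rw [this]; exact add _ _ (ih 0) (ih 1)
    | mul =>
      have : ts = ![ts 0, ts 1] := by funext i; fin_cases i <;> rfl
      rw [this]; exact mul _ _ (ih 0) (ih 1)

section Composition

variable {M : Type*} [arith.Structure M] {n m : ℕ}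

/-- All operations of the language are monotone in each argument. Majorants by terms can therefore
be composed, as `BddFn.comp` needs. -/
theorem Models.realize_mono (hM : Models M IDelta0) {α : Type} {v w : α → M}
    (h : ∀ i, leM (v i) (w i)) (t : arith.Term α) : leM (t.realize v) (t.realize w) := by
  let _ := hM.commSemiring
  let _ := hM.linearOrder
  have := hM.isStrictOrderedRing
  have := hM.canonicallyOrderedAdd
  induction t using arith_term_induction with
  | var x => exact h x
  | zero => simpa using hM.le_refl _
  | succ t ih =>
    simp only [realize_tsucc, hM.succ_eq_add_one]
    exact add_le_add_left (α := M) ih 1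
  | add t s ih ih' =>
    simp only [realize_tadd]
    exact add_le_add (α := M) ih ih'
  | mul t s ih ih' =>
    simp only [realize_tmul]
    exact mul_le_mul' (α := M) ih ih'

theorem PolyFn.mono (hM : Models M IDelta0) {f : (Fin n → M) → M} (hf : PolyFn f)
    {v w : Fin n → M} (h : ∀ i, leM (v i) (w i)) : leM (f v) (f w) := by
  obtain ⟨N, c, t, ht⟩ := hf
  rw [ht, ht]
  refine hM.realize_mono (fun i => ?_) t
  refine Fin.addCases (fun i => ?_) (fun i => ?_) i
  · simpa using hM.le_refl _
  · simpa using h i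

theorem PolyFn.rename {f : (Fin n → M) → M} (hf : PolyFn f) (r : Fin n → Fin m) :
    PolyFn fun w : Fin m → M => f fun i => w (r i) := by
  obtain ⟨N, c, t, ht⟩ := hf
  refine ⟨N, c, t.relabel (Fin.addCases (Fin.castAdd m) fun i => Fin.natAdd N (r i)), fun v => ?_⟩
  simp only [ht, Term.realize_relabel]
  congr 1
  funext i
  refine Fin.addCases (fun i => ?_) (fun i => ?_) i <;> simp

theorem PolyFn.init {f : (Fin n → M) → M} (hf : PolyFn f) :
    PolyFn fun w : Fin (n + 1) → M => f (Fin.init w) :=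
  hf.rename Fin.castSucc

theorem PolyFn.comp {h : (Fin m → M) → M} (hh : PolyFn h) {f : Fin m → (Fin n → M) → M}
    (hf : ∀ i, PolyFn (f i)) : PolyFn fun v => h fun i => f i v := by
  obtain ⟨N, c, t, ht⟩ := hh
  have key : ∀ t : arith.Term (Fin (N + m)),
      PolyFn fun v => t.realize (Fin.append c fun i => f i v) := by
    intro t
    induction t using arith_term_induction with
    | var x =>
      refine Fin.addCases (fun i => ?_) (fun i => ?_) x
      · simpa using PolyFn.const _
      · simpa using hf i
    | zero => simpa using PolyFn.const _
    | succ t ih => simpa using ih.succ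
    | add t s ih ih' => simpa using ih.add ih'
    | mul t s ih ih' => simpa using ih.mul ih'
  simpa only [ht] using key t

theorem BddFn.rename {f : (Fin n → M) → M} (hf : BddFn f) (r : Fin n → Fin m) :
    BddFn fun w : Fin m → M => f fun i => w (r i) := by
  obtain ⟨hd, g, hg, hfg⟩ := hf
  refine ⟨?_, _, hg.rename r, fun v => hfg _⟩
  refine (hd.substPoly (fun i (w : Fin (m + 1) → M) =>
    w ((Fin.snoc (fun i => (r i).castSucc) (Fin.last m) : Fin (n + 1) → _) i))
    fun i => .var _).congr fun w => ?_
  have : (Fin.init fun i => w ((Fin.snoc (fun i => (r i).castSucc) (Fin.last m) :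
      Fin (n + 1) → _) i)) = fun i => Fin.init w (r i) := by
    funext i
    simp [Fin.init]
  simp only [this, Fin.snoc_last]

theorem BddFn.init {f : (Fin n → M) → M} (hf : BddFn f) :
    BddFn fun w : Fin (n + 1) → M => f (Fin.init w) :=
  hf.rename Fin.castSucc

theorem PolyFn.bddFn (hM : Models M IDelta0) {f : (Fin n → M) → M} (hf : PolyFn f) : BddFn f :=
  ⟨(PolyFn.var _).eq hf.init, f, hf, fun _ => hM.le_refl _⟩

/-- `Q v (f v)` says that some `a ≤ g v` satisfies `a = f v` and `Q v a`: the majorant `g` bounds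
the quantifier and the graph of `f` has a bounded definition. -/
theorem BddFn.substLast {Q : (Fin n → M) → M → Prop} {f : (Fin n → M) → M} (hf : BddFn f)
    (hQ : BddDef fun w : Fin (n + 1) → M => Q (Fin.init w) (w (Fin.last n))) :
    BddDef fun v => Q v (f v) := by
  obtain ⟨hd, g, hg, hfg⟩ := hf
  refine (BddDef.ex (P := fun v a => a = f v ∧ Q v a) hg (hd.and hQ)).congr fun v => ?_
  exact ⟨fun h => ⟨f v, hfg v, rfl, h⟩, fun ⟨a, _, e, h⟩ => e ▸ h⟩

/-- The functions are substituted one at a time. The relation keeps `v` as an extra argument because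
the functions that have been substituted still depend on it. -/
theorem BddDef.comp_aux (R : (Fin n → M) → (Fin m → M) → Prop)
    (hR : BddDef fun w : Fin (n + m) → M =>
      R (fun i => w (Fin.castAdd m i)) fun i => w (Fin.natAdd n i))
    {f : Fin m → (Fin n → M) → M} (hf : ∀ i, BddFn (f i)) : BddDef fun v => R v fun i => f i v := by
  induction m with
  | zero =>
    refine hR.congr fun v => iff_of_eq ?_
    congr 1
    funext i
    exact i.elim0
  | succ m ih =>
    have h := ih (fun v u => R v (Fin.snoc u (f (Fin.last m) v) : Fin (m + 1) → M)) ?_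
      (f := fun i => f i.castSucc) fun i => hf _
    · refine h.congr fun v => iff_of_eq ?_
      congr 1
      funext i
      refine Fin.lastCases ?_ (fun i => ?_) i <;> simp
    · have h1 : BddFn fun w : Fin (n + m) → M => f (Fin.last m) fun i => w (Fin.castAdd m i) :=
        (hf _).rename _
      refine BddFn.substLast (Q := fun w a => R (fun i => w (Fin.castAdd m i))
        (Fin.snoc (fun i => w (Fin.natAdd n i)) a : Fin (m + 1) → M)) h1 ?_
      refine hR.congr fun w => iff_of_eq ?_
      congr 1
      funext i
      refine Fin.lastCases ?_ (fun i => ?_) i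
      · rw [Fin.snoc_last]; rfl
      · rw [Fin.snoc_castSucc]; rfl

theorem BddDef.comp {P : (Fin m → M) → Prop} (hP : BddDef P)
    {f : Fin m → (Fin n → M) → M} (hf : ∀ i, BddFn (f i)) : BddDef fun v => P fun i => f i v :=
  BddDef.comp_aux (fun _ u => P u) (hP.substPoly (fun i w => w (Fin.natAdd n i)) fun _ => .var _) hf

theorem BddFn.comp (hM : Models M IDelta0) {h : (Fin m → M) → M} (hh : BddFn h)
    {f : Fin m → (Fin n → M) → M} (hf : ∀ i, BddFn (f i)) : BddFn fun v => h fun i => f i v := by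
  obtain ⟨hd, g, hg, hhg⟩ := hh
  refine ⟨?_, fun v => g fun i => (hf i).2.choose v, hg.comp fun i => (hf i).2.choose_spec.1,
    fun v => hM.le_trans (hhg _) (hg.mono hM fun i => (hf i).2.choose_spec.2 v)⟩
  refine (hd.comp (f := (Fin.snoc (fun i w => f i (Fin.init w)) (fun w => w (Fin.last n)) :
    Fin (m + 1) → (Fin (n + 1) → M) → M)) fun i => ?_).congr fun w => ?_
  · refine Fin.lastCases ?_ (fun i => ?_) i
    · simpa using (PolyFn.var _).bddFn hM
    · simpa using (hf i).init
  · have : (Fin.init fun i => (Fin.snoc (fun i w => f i (Fin.init w)) (fun w => w (Fin.last n)) :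
        Fin (m + 1) → (Fin (n + 1) → M) → M) i w) = fun i => f i (Fin.init w) := by
      funext i
      simp [Fin.init]
    simp only [this, Fin.snoc_last]

theorem BddFn.comp₁ (hM : Models M IDelta0) {F : M → M} (hF : BddFn fun v : Fin 1 → M => F (v 0))
    {f : (Fin n → M) → M} (hf : BddFn f) : BddFn fun v => F (f v) :=
  BddFn.comp hM hF (f := fun _ => f) fun _ => hf

theorem BddDef.comp₂ {P : M → M → Prop} (hP : BddDef fun v : Fin 2 → M => P (v 0) (v 1))
    {f g : (Fin n → M) → M} (hf : BddFn f) (hg : BddFn g) : BddDef fun v => P (f v) (g v) :=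
  BddDef.comp hP (f := ![f, g]) fun i => by fin_cases i; exacts [hf, hg]

theorem BddFn.comp₂ (hM : Models M IDelta0) {F : M → M → M}
    (hF : BddFn fun v : Fin 2 → M => F (v 0) (v 1))
    {f g : (Fin n → M) → M} (hf : BddFn f) (hg : BddFn g) : BddFn fun v => F (f v) (g v) :=
  BddFn.comp hM hF (f := ![f, g]) fun i => by fin_cases i; exacts [hf, hg]

theorem BddFn.eq {f g : (Fin n → M) → M} (hf : BddFn f) (hg : BddFn g) :
    BddDef fun v => f v = g v :=
  BddDef.comp₂ (P := fun a b => a = b) ((PolyFn.var 0).eq (.var 1)) hf hg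

theorem BddFn.mul (hM : Models M IDelta0) {f g : (Fin n → M) → M} (hf : BddFn f) (hg : BddFn g) :
    BddFn fun v => mulM (f v) (g v) :=
  BddFn.comp₂ hM (((PolyFn.var 0).mul (.var 1)).bddFn hM) hf hg

end Composition

/-! ## Definability of concatenation and of internal iterations -/

section Concatenation

variable {M : Type*} [arith.Structure M] {n : ℕ}

theorem bddDef_isPow2 {f : (Fin n → M) → M} (hf : PolyFn f) : BddDef fun v => IsPow2 (f v) := by
  -- The bounds are moved next to their quantifiers, to give the official form of bounded
  -- quantification.
  have h : BddDef fun v => f v ≠ zeroM ∧ ∀ d, leM d (f v) → ∀ e, leM e (f v) → mulM d e = f v →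
      d = succM zeroM ∨ ∃ c, leM c d ∧ addM c c = d := by
    refine (hf.eq (.const _)).not.and (BddDef.all (P := fun v d => ∀ e, leM e (f v) →
      mulM d e = f v → d = succM zeroM ∨ ∃ c, leM c d ∧ addM c c = d) hf ?_)
    refine BddDef.all (P := fun w e => mulM (w (Fin.last n)) e = f (Fin.init w) →
      w (Fin.last n) = succM zeroM ∨
        ∃ c, leM c (w (Fin.last n)) ∧ addM c c = w (Fin.last n)) hf.init ?_
    have hd : PolyFn fun w : Fin (n + 1 + 1) → M => Fin.init w (Fin.last n) :=
      (PolyFn.var (Fin.last n)).init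
    refine ((hd.mul (.var _)).eq hf.init.init).imp ((hd.eq (.const _)).or ?_)
    exact BddDef.ex (P := fun w c => addM c c = Fin.init w (Fin.last n)) hd
      (((PolyFn.var _).add (.var _)).eq hd.init)
  exact h.congr fun v => and_congr_right fun _ =>
    ⟨fun h d hd e he => h d e hd he, fun h d e hd he => h d hd e he⟩

theorem bddDef_isTop {f g : (Fin n → M) → M} (hf : PolyFn f) (hg : PolyFn g) :
    BddDef fun v => IsTop (f v) (g v) := by
  refine (bddDef_isPow2 hg).and ((hg.le hf).and ?_)
  exact BddDef.all (P := fun v Q => IsPow2 Q → leM Q (g v)) hf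
    ((bddDef_isPow2 (.var _)).imp ((PolyFn.var _).le hg.init))

/-- `R` is left open to serve twice: with `z = x P + r` it gives the graph of concatenation, and
with `True` the condition that a concatenation exists at all. -/
theorem bddDef_ex_isTop {f : (Fin n → M) → M} (hf : PolyFn f)
    {R : (Fin n → M) → M → M → Prop} (hR : BddDef fun w : Fin (n + 1 + 1) → M =>
      R (Fin.init (Fin.init w)) (Fin.init w (Fin.last n)) (w (Fin.last (n + 1)))) :
    BddDef fun v => ∃ P r, leM P (f v) ∧ leM r (f v) ∧ IsTop (f v) P ∧ addM P r = f v ∧ R v P r := by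
  have h : BddDef fun v => ∃ P, leM P (f v) ∧ ∃ r, leM r (f v) ∧ IsTop (f v) P ∧
      addM P r = f v ∧ R v P r := by
    refine BddDef.ex (P := fun v P => ∃ r, leM r (f v) ∧ IsTop (f v) P ∧
      addM P r = f v ∧ R v P r) hf ?_
    refine BddDef.ex (P := fun w r => IsTop (f (Fin.init w)) (w (Fin.last n)) ∧
      addM (w (Fin.last n)) r = f (Fin.init w) ∧ R (Fin.init w) (w (Fin.last n)) r) hf.init ?_
    have hP : PolyFn fun w : Fin (n + 1 + 1) → M => Fin.init w (Fin.last n) :=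
      (PolyFn.var (Fin.last n)).init
    exact (bddDef_isTop hf.init.init hP).and (((hP.add (.var _)).eq hf.init.init).and hR)
  refine h.congr fun v => ?_
  constructor
  · rintro ⟨P, r, h1, h2, h3⟩; exact ⟨P, h1, r, h2, h3⟩
  · rintro ⟨P, h1, r, h2, h3⟩; exact ⟨P, r, h1, h2, h3⟩

theorem IsConc.unique (hM : Models M IDelta0) {x y z z' : M} (h : IsConc x y z)
    (h' : IsConc x y z') : z = z' := by
  obtain ⟨P, r, -, -, ht, e, rfl⟩ := h
  obtain ⟨P', r', -, -, ht', e', rfl⟩ := h'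
  have hP : P = P' := hM.le_antisymm (ht'.2.2 _ ht.2.1 ht.1) (ht.2.2 _ ht'.2.1 ht'.1)
  subst hP
  rw [hM.add_left_cancel (e.trans e'.symm)]

/-- Replaces the choice in `conc` by a bounded description that includes the default value. Whether
a concatenation exists depends only on decomposing `y`, a bounded condition, so the existence of a
largest power of two need not be proved. -/
theorem eq_conc_iff (hM : Models M IDelta0) (x y z : M) :
    z = conc x y ↔ IsConc x y z ∨ ((¬ ∃ P r, leM P y ∧ leM r y ∧ IsTop y P ∧ addM P r = y ∧ True) ∧
      z = zeroM) := by
  have hex : (∃ z, IsConc x y z) ↔ ∃ P r, leM P y ∧ leM r y ∧ IsTop y P ∧ addM P r = y ∧ True :=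
    ⟨fun ⟨_, P, r, h1, h2, h3, h4, _⟩ => ⟨P, r, h1, h2, h3, h4, trivial⟩,
      fun ⟨P, r, h1, h2, h3, h4, _⟩ => ⟨_, P, r, h1, h2, h3, h4, rfl⟩⟩
  rw [← hex]
  by_cases h : ∃ z, IsConc x y z
  · have hs : IsConc x y (conc x y) := by
      rw [conc, dif_pos h]; exact h.choose_spec
    constructor
    · rintro rfl; exact Or.inl hs
    · rintro (h' | ⟨h', -⟩)
      · exact h'.unique hM hs
      · exact absurd h h'
  · rw [conc, dif_neg h]
    constructor
    · exact fun e => Or.inr ⟨h, e⟩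
    · rintro (h' | ⟨-, e⟩)
      · exact absurd ⟨z, h'⟩ h
      · exact e

/-- In `x P + r` both `P` and `r` are at most `y`; the default value `0` is harmless. -/
theorem conc_le (hM : Models M IDelta0) (x y : M) : leM (conc x y) (addM (mulM x y) y) := by
  let _ := hM.commSemiring
  let _ := hM.linearOrder
  have := hM.isStrictOrderedRing
  have := hM.canonicallyOrderedAdd
  rcases (eq_conc_iff hM x y _).1 rfl with ⟨P, r, h1, h2, -, -, e⟩ | ⟨-, e⟩
  · rw [e]
    exact add_le_add (α := M) (mul_le_mul' (α := M) le_rfl h1) h2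
  · rw [e]
    exact zero_le (a := (_ : M))

theorem BddFn.conc (hM : Models M IDelta0) {f g : (Fin n → M) → M} (hf : BddFn f)
    (hg : BddFn g) : BddFn fun v => conc (f v) (g v) := by
  refine BddFn.comp₂ hM ⟨?_, fun v => addM (mulM (v 0) (v 1)) (v 1),
    ((PolyFn.var _).mul (.var _)).add (.var _), fun v => conc_le hM _ _⟩ hf hg
  have h0 : PolyFn fun w : Fin 3 → M => w 0 := .var 0
  have h1 : PolyFn fun w : Fin 3 → M => w 1 := .var 1
  have h2 : PolyFn fun w : Fin 3 → M => w 2 := .var 2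
  refine BddDef.congr (BddDef.or (bddDef_ex_isTop (R := fun w P r => w 2 = addM (mulM (w 0) P) r)
    h1 ?_) ((bddDef_ex_isTop (R := fun w P r => True) h1 ?_).not.and (h2.eq (.const zeroM))))
    fun w => eq_conc_iff hM (w 0) (w 1) (w 2)
  · exact h2.init.init.eq ((h0.init.init.mul (PolyFn.var (Fin.last 3)).init).add (.var _))
  · exact ((PolyFn.const zeroM).eq (.const zeroM)).congr fun _ => by simp

/-- The witnessing function of an internal iteration can be taken to be definable. -/
theorem IsIterate.exists_bddFn {a : M} {g : M → M} {j x : M} (h : IsIterate a g j x)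
    (hM : Models M IDelta0) :
    ∃ F : M → M, BddFn (fun v : Fin 1 → M => F (v 0)) ∧ F zeroM = a ∧
      (∀ i, leM (succM i) j → F (succM i) = g (F i)) ∧ F j = x := by
  classical
  obtain ⟨F, hF, h0, hs, hx⟩ := h
  have hz : leM zeroM j := hM.le_iff.2 ⟨j, hM.zero_add j⟩
  obtain ⟨b, hb⟩ := hF.1
  have hd := hF.bddDef
  -- Beyond `j` the given `F` is arbitrary, so it is reset to `0` there. The bound `b` of the
  -- internal graph is then a constant majorant.
  refine ⟨fun i => if leM i j then F i else zeroM, ⟨?_, fun _ => b, .const _, fun v => ?_⟩,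
    by simpa [hz] using h0, fun i hi => ?_, by simpa [hM.le_refl] using hx⟩
  · have hv : PolyFn fun w : Fin 2 → M => w 0 := .var 0
    have hw : PolyFn fun w : Fin 2 → M => w 1 := .var 1
    refine (hd.or ((hv.le (.const j)).not.and (hw.eq (.const zeroM)))).congr fun w => ?_
    change (w 1 = if leM (w 0) j then F (w 0) else zeroM) ↔
      (leM (w 0) j ∧ w 1 = F (w 0)) ∨ (¬ leM (w 0) j ∧ w 1 = zeroM)
    by_cases hj : leM (w 0) j <;> simp [hj]
  · by_cases hj : leM (v 0) j
    · simp only [hj, if_true]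
      exact hb ![v 0, F (v 0)] ⟨hj, rfl⟩ 1
    · simp only [hj, if_false]
      exact hM.le_iff.2 ⟨b, hM.zero_add b⟩
  · have hi' : leM i j := hM.le_trans (hM.le_iff.2 ⟨succM zeroM, by
      rw [hM.add_succ, hM.add_zero]⟩) hi
    simpa [hi, hi'] using hs i hi

/-- Bounded induction on `i`. The lengths `j` and `j'` may differ, so that a short sequence can be
compared with an initial part of a long one. -/
theorem iterate_unique (hM : Models M IDelta0) {F G : M → M} {g : M → M} {j j' : M}
    (hF : BddFn fun v : Fin 1 → M => F (v 0)) (hG : BddFn fun v : Fin 1 → M => G (v 0))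
    (h0 : F zeroM = G zeroM) (hFs : ∀ i, leM (succM i) j → F (succM i) = g (F i))
    (hGs : ∀ i, leM (succM i) j' → G (succM i) = g (G i)) (i : M) :
    leM i j → leM i j' → F i = G i := by
  refine hM.induction (P := fun i => leM i j → leM i j' → F i = G i)
    (((PolyFn.var 0).le (.const _)).imp (((PolyFn.var 0).le (.const _)).imp (hF.eq hG)))
    (fun _ _ => h0) (fun i ih h h' => ?_) i
  have hi : leM i (succM i) := hM.le_iff.2 ⟨succM zeroM, by rw [hM.add_succ, hM.add_zero]⟩
  rw [hFs i h, hGs i h', ih (hM.le_trans hi h) (hM.le_trans hi h')]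

end Concatenation

/-! ## Powers lie below `ω₁` -/

section Omega

variable {M : Type*} [arith.Structure M]

theorem Models.eq_std_of_le (hM : Models M IDelta0) {x : M} {n : ℕ} (h : leM x (stdM n)) :
    ∃ m, x = stdM m := by
  let _ := hM.commSemiring
  let _ := hM.linearOrder
  have := hM.isStrictOrderedRing
  have := hM.canonicallyOrderedAdd
  induction n generalizing x with
  | zero => exact ⟨0, hM.le_antisymm h (zero_le (a := x))⟩
  | succ n ih =>
    by_cases hx : x = zeroM
    · exact ⟨0, hx⟩
    · obtain ⟨y, rfl⟩ := hM.exists_pred hx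
      have hy : leM y (stdM n) := by
        have h' : succM y ≤ succM (stdM n) := h
        rw [hM.succ_eq_add_one, hM.succ_eq_add_one] at h'
        exact (add_le_add_iff_right (α := M) 1).1 h'
      obtain ⟨m, rfl⟩ := ih hy
      exact ⟨m + 1, rfl⟩

/-- With `l = log α` and `G` the sequence of powers of two that witnesses `ω = exp(l l)`, one has `α
≤ G l`, hence `α ^ k ≤ G (k l) ≤ G (l l) = ω` as soon as `k ≤ l`. -/
theorem Models.pow_le_omega1 (hM : Models M IDelta0) {α ω : M} (hα : ∀ n : ℕ, α ≠ stdM n)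
    (hω : IsOmega1 α ω) (k : ℕ) : leM (powM α k) ω := by
  let _ := hM.commSemiring
  let _ := hM.linearOrder
  have := hM.isStrictOrderedRing
  have := hM.canonicallyOrderedAdd
  obtain ⟨l, ⟨⟨e, he, hαe⟩, -⟩, hω⟩ := hω
  obtain ⟨H, hH, hH0, hHs, hHl⟩ := IsIterate.exists_bddFn he hM
  obtain ⟨G, hG, hG0, hGs, hGl⟩ := IsIterate.exists_bddFn hω hM
  -- If `l` were a standard `m`, then `exp(l)` would be the standard number `2 ^ m`, and `α` below
  -- it would be standard as well.
  have hkl : ∀ k : ℕ, (k : M) ≤ l := by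
    intro k
    by_contra hk
    obtain ⟨m, rfl⟩ := hM.eq_std_of_le (n := k) (le_of_not_ge (α := M) hk)
    have hstd : ∀ i : ℕ, i ≤ m → H (stdM i) = stdM (2 ^ i) := by
      intro i
      induction i with
      | zero => exact fun _ => hH0
      | succ i ih =>
        intro hi
        refine (hHs (stdM i) (Nat.cast_le (α := M).2 hi)).trans ?_
        rw [ih (by omega), pow_succ, mul_two]
        exact (Nat.cast_add (R := M) _ _).symm
    rw [hstd m le_rfl] at hHl
    rw [← hHl] at hαe
    obtain ⟨n, hn⟩ := hM.eq_std_of_le hαe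
    exact hα n hn
  have hl1 : (1 : M) ≤ l := by simpa using hkl 1
  have hll : l ≤ l * l := le_mul_of_one_le_left (zero_le (a := l)) hl1
  -- The sequences witnessing `exp(l)` and `exp(l l)` obey the same recursion, so they agree up to
  -- `l ≤ l l`.
  have hαG : α ≤ G l := by
    have := iterate_unique hM (g := fun z => addM z z) hH hG (hH0.trans hG0.symm) hHs hGs l (hM.le_refl l) hll
    rw [← this, hHl]; exact hαe
  replace hGs : ∀ i : M, i + 1 ≤ l * l → G (i + 1) = G i + G i := by
    intro i hi
    have := hGs i (by rw [hM.succ_eq_add_one]; exact hi)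
    rw [hM.succ_eq_add_one] at this
    exact this
  -- Exponentiation need not be total in `M`, so the functional equation is claimed only as far as
  -- the recursion of `G` reaches.
  have hGadd : ∀ i j : M, i + j ≤ l * l → G (i + j) = G i * G j := by
    intro i
    refine hM.induction (P := fun j => leM (addM i j) (mulM l l) → G (addM i j) = mulM (G i) (G j))
      ((((PolyFn.const _).add (.var 0)).le (.const _)).imp
        ((BddFn.comp₁ hM hG (((PolyFn.const i).add (.var 0)).bddFn hM)).eq
          (((PolyFn.const (G i)).bddFn hM).mul hM hG))) ?_ (fun j ih h => ?_)
    · intro _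
      rw [hM.add_zero, hG0, hM.mul_one]
    · rw [hM.add_succ, hM.succ_eq_add_one] at h ⊢
      have h1 : j + 1 ≤ l * l :=
        _root_.le_trans (add_le_add_left (le_add_self (a := j) (b := i)) 1) h
      rw [hGs _ h, ih (_root_.le_trans (α := M) (le_self_add (a := addM i j) (b := (1 : M))) h),
        hM.succ_eq_add_one, hGs j h1]
      exact (_root_.mul_add (G i) (G j) (G j)).symm
  have hGmono : ∀ i j : M, i + j ≤ l * l → G i ≤ G (i + j) := by
    intro i
    refine hM.induction (P := fun j => leM (addM i j) (mulM l l) → leM (G i) (G (addM i j)))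
      ((((PolyFn.const _).add (.var 0)).le (.const _)).imp
        (BddDef.comp₂ (P := leM) ((PolyFn.var 0).le (.var 1)) ((PolyFn.const (G i)).bddFn hM)
          (BddFn.comp₁ hM hG (((PolyFn.const i).add (.var 0)).bddFn hM)))) ?_ (fun j ih h => ?_)
    · intro _
      rw [hM.add_zero]; exact hM.le_refl _
    · rw [hM.add_succ, hM.succ_eq_add_one] at h ⊢
      rw [hGs _ h]
      exact _root_.le_trans (α := M) (ih (_root_.le_trans (α := M) (le_self_add (a := addM i j) (b := (1 : M))) h))
        le_self_add
  have hpow : ∀ k : ℕ, α ^ k ≤ G (k * l) := by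
    intro k
    induction k with
    | zero =>
      have : G 0 = 1 := hG0
      simp [this]
    | succ k ih =>
      -- From `k + 1 ≤ l`: the argument `(k + 1) l` stays in the range of `G`.
      have hk : (k : M) * l + l ≤ l * l := by
        have := mul_le_mul' (hkl (k + 1)) (_root_.le_refl l)
        rwa [Nat.cast_succ, add_mul, one_mul] at this
      rw [pow_succ, Nat.cast_succ, add_mul, one_mul, hGadd _ _ hk]
      exact mul_le_mul' ih hαG
  rw [hM.powM_eq, ← hGl]
  obtain ⟨d, hd⟩ := hM.le_iff.1 (mul_le_mul' (hkl k) (_root_.le_refl l))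
  refine _root_.le_trans (α := M) (hpow k) ?_
  have := hGmono (k * l) d (le_of_eq hd)
  rwa [show (k : M) * l + d = l * l from hd] at this

end Omega

/-! ## Negation normal forms -/

/-- Refuting a Skolem form from a failing formula is an induction that never passes under a
negation, except in front of an atom; this predicate provides that induction. -/
inductive Fml.IsNNF : {n : ℕ} → Fml n → Prop
  | eq {n : ℕ} (t s : arith.Term (Fin n)) : IsNNF (.eq t s)
  | le {n : ℕ} (t s : arith.Term (Fin n)) : IsNNF (.le t s)
  | neg_eq {n : ℕ} (t s : arith.Term (Fin n)) : IsNNF (.neg (.eq t s))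
  | neg_le {n : ℕ} (t s : arith.Term (Fin n)) : IsNNF (.neg (.le t s))
  | and {n : ℕ} {φ ψ : Fml n} (h : IsNNF φ) (h₂ : IsNNF ψ) : IsNNF (.and φ ψ)
  | or {n : ℕ} {φ ψ : Fml n} (h : IsNNF φ) (h₂ : IsNNF ψ) : IsNNF (.or φ ψ)
  | all {n : ℕ} {φ : Fml (n + 1)} (h : IsNNF φ) : IsNNF (.all φ)
  | ex {n : ℕ} {φ : Fml (n + 1)} (h : IsNNF φ) : IsNNF (.ex φ)

theorem Fml.isNNF_nnf {n : ℕ} (φ : Fml n) : ∀ b, (φ.nnf b).IsNNF := by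
  induction φ with
  | eq t s => intro b; cases b; exacts [.neg_eq _ _, .eq _ _]
  | le t s => intro b; cases b; exacts [.neg_le _ _, .le _ _]
  | neg φ ih => intro b; cases b <;> exact ih _
  | and φ ψ ih ih' => intro b; cases b; exacts [.or (ih _) (ih' _), .and (ih _) (ih' _)]
  | or φ ψ ih ih' => intro b; cases b; exacts [.and (ih _) (ih' _), .or (ih _) (ih' _)]
  | imp φ ψ ih ih' => intro b; cases b; exacts [.and (ih _) (ih' _), .or (ih _) (ih' _)]
  | all φ ih => intro b; cases b; exacts [.ex (ih _), .all (ih _)]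
  | ex φ ih => intro b; cases b; exacts [.all (ih _), .ex (ih _)]

/-- Both polarities are treated at once, since negation and the premise of an implication exchange
them. -/
theorem Fml.realize_nnf {M : Type*} [arith.Structure M] {n : ℕ} (φ : Fml n) :
    ∀ v : Fin n → M, ((φ.nnf true).Realize v ↔ φ.Realize v) ∧
      ((φ.nnf false).Realize v ↔ ¬ φ.Realize v) := by
  induction φ with
  | eq t s => intro v; exact ⟨Iff.rfl, Iff.rfl⟩
  | le t s => intro v; exact ⟨Iff.rfl, Iff.rfl⟩
  | neg φ ih =>
    intro v
    simp only [Fml.nnf, Fml.Realize, Bool.not_true, Bool.not_false, (ih v).1, (ih v).2, not_not,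
      and_self]
  | and φ ψ ih ih' =>
    intro v
    simp only [Fml.nnf, Fml.Realize, (ih v).1, (ih v).2, (ih' v).1, (ih' v).2]
    tauto
  | or φ ψ ih ih' =>
    intro v
    simp only [Fml.nnf, Fml.Realize, (ih v).1, (ih v).2, (ih' v).1, (ih' v).2]
    tauto
  | imp φ ψ ih ih' =>
    intro v
    simp only [Fml.nnf, Fml.Realize, (ih v).1, (ih v).2, (ih' v).1, (ih' v).2]
    tauto
  | all φ ih =>
    intro v
    simp only [Fml.nnf, Fml.Realize, (ih _).1, (ih _).2, not_forall, and_self]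
  | ex φ ih =>
    intro v
    simp only [Fml.nnf, Fml.Realize, (ih _).1, (ih _).2, not_exists, and_self]

/-! ## Herbrand models satisfy the theory -/

section Herbrand

variable {M : Type*} [arith.Structure M]

theorem level_mono (Λ : Set M) : Monotone (level Λ) :=
  monotone_nat_of_le_succ fun _ _ hx => Or.inl (Or.inl hx)

/-- The Gödel number of `∃ x ψ` is standard, so the symbol is admitted from some standard level on;
the level is chosen above this number and above those of the arguments. -/
theorem app_skSymbol_mem_hull {Λ : Set M} {n : ℕ} (ψ : Fml (n + 1))
    (t : Fin (Fml.ex ψ).fv.card → M) (ht : ∀ i, t i ∈ hull Λ) : app (skSymbol ψ) t ∈ hull Λ := by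
  choose l hl using fun i => Set.mem_iUnion.1 (ht i)
  refine Set.mem_iUnion.2 ⟨max (Finset.univ.sup l) (Fml.ex ψ).godel + 1,
    Or.inr ⟨n, ψ, t, le_max_right _ _, fun i => ?_, rfl⟩⟩
  exact level_mono Λ ((Finset.le_sup (f := l) (Finset.mem_univ i)).trans (le_max_left _ _)) (hl i)

/-- Consequently every Skolem instance with values in the hull is available there. -/
theorem termCode_mem_hull {Λ : Set M} {V : Type} {τ : V → M} (hτ : ∀ x, τ x ∈ hull Λ)
    (t : arithSk.Term V) : termCode τ t ∈ hull Λ := by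
  induction t with
  | var x => exact hτ x
  | func f ts ih =>
    rcases f with f | f
    · exact app_mem_hull f _ ih
    · cases f with
      | sk ψ => exact app_skSymbol_mem_hull ψ _ ih


/-- `τ` and `τ'` agree on the variables that do not extend `π`. -/
def EqOff {α : Type*} (π : List Bool) (τ τ' : List Bool → α) : Prop :=
  ∀ x, ¬ π <+: x → τ x = τ' x

theorem EqOff.of_append {α : Type*} {π π' : List Bool} {τ τ' : List Bool → α}
    (h : EqOff (π ++ π') τ τ') : EqOff π τ τ' :=
  fun x hx => h x fun h' => hx ((List.prefix_append _ _).trans h')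

theorem termCode_subst {V W : Type} (τ : W → M) (σ : V → arithSk.Term W) (t : arithSk.Term V) :
    termCode τ (t.subst σ) = termCode (fun x => termCode τ (σ x)) t := by
  induction t with
  | var x => rfl
  | func f ts ih =>
    simp only [Term.subst, termCode]
    congr 1
    funext i
    exact ih i

/-- A variable of `φ.skolem σ π` either comes from `σ` or is named by a position extending `π`; no
other value matters. -/
theorem sat_skolem_congr {p : TermValuation M} {n : ℕ} (φ : Fml n) :
    ∀ (σ : Fin n → arithSk.Term (List Bool)) (π : List Bool) (τ τ' : List Bool → M),
      (∀ i, termCode τ (σ i) = termCode τ' (σ i)) → (∀ x, π <+: x → τ x = τ' x) →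
      (p.Sat τ (φ.skolem σ π) ↔ p.Sat τ' (φ.skolem σ π)) := by
  have ext : ∀ {π π' : List Bool} {τ τ' : List Bool → M}, (∀ x, π <+: x → τ x = τ' x) →
      ∀ x, π ++ π' <+: x → τ x = τ' x :=
    fun h x hx => h x ((List.prefix_append _ _).trans hx)
  induction φ with
  | eq t s =>
    intro σ π τ τ' h _
    simp only [Fml.skolem, TermValuation.Sat, termCode_subst, h]
  | le t s =>
    intro σ π τ τ' h _
    simp only [Fml.skolem, TermValuation.Sat, termCode_subst, h]
  | neg φ ih =>
    intro σ π τ τ' h h'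
    exact not_congr (ih σ _ τ τ' h (ext h'))
  | and φ ψ ih ih' =>
    intro σ π τ τ' h h'
    exact and_congr (ih σ _ τ τ' h (ext h')) (ih' σ _ τ τ' h (ext h'))
  | or φ ψ ih ih' =>
    intro σ π τ τ' h h'
    exact or_congr (ih σ _ τ τ' h (ext h')) (ih' σ _ τ τ' h (ext h'))
  | imp φ ψ ih ih' =>
    intro σ π τ τ' h h'
    exact or_congr (not_congr (ih σ _ τ τ' h (ext h'))) (ih' σ _ τ τ' h (ext h'))
  | all φ ih =>
    intro σ π τ τ' h h'
    refine ih _ _ τ τ' (fun i => ?_) (ext h')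
    refine Fin.lastCases ?_ (fun i => ?_) i
    · simpa [termCode] using h' π (List.prefix_refl π)
    · simpa using h i
  | ex φ ih =>
    intro σ π τ τ' h h'
    refine ih _ _ τ τ' (fun i => ?_) (ext h')
    refine Fin.lastCases ?_ (fun i => ?_) i
    · simp [termCode, h]
    · simpa using h i

variable {p : TermValuation M} {Λ : Set M} (h : p.IsEvaluation (hull Λ))

/-- The closed term, in the hull, given by a term and an assignment in the hull. -/
noncomputable def hullTerm {V : Type} (τ : V → hull Λ) (t : arithSk.Term V) : hull Λ :=
  ⟨termCode (fun x => (τ x : M)) t, termCode_mem_hull (fun x => (τ x).2) t⟩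

theorem HerbrandModel.mk_surjective (a : HerbrandModel h) : ∃ t, HerbrandModel.mk h t = a :=
  Quotient.exists_rep a

theorem HerbrandModel.mk_eq_mk {t s : hull Λ} :
    HerbrandModel.mk h t = HerbrandModel.mk h s ↔ p.eq t s :=
  Quotient.eq (r := h.setoid)

theorem HerbrandModel.leM_mk {t s : hull Λ} :
    leM (HerbrandModel.mk h t) (HerbrandModel.mk h s) ↔ p.le t s := by
  let _ := prestructure h
  have := relMap_quotient_mk' (s := h.setoid) (L := arith) (r := ArithRel.le) ![t, s]
  refine Iff.trans (iff_of_eq ?_) this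
  refine congrArg (Structure.RelMap (L := arith) ArithRel.le) ?_
  funext i
  fin_cases i <;> rfl

theorem HerbrandModel.funMap_mk {k : ℕ} (f : ArithFunc k) (x : Fin k → hull Λ) :
    Structure.funMap (L := arith) f (fun i => HerbrandModel.mk h (x i)) =
      HerbrandModel.mk h ⟨app (baseSymbol f) fun i => (x i : M),
        app_mem_hull f _ fun i => (x i).2⟩ := by
  let _ := prestructure h
  exact funMap_quotient_mk' (s := h.setoid) (L := arith) f x

theorem HerbrandModel.realize_mk {n : ℕ} (τ : List Bool → hull Λ)
    (σ : Fin n → arithSk.Term (List Bool)) (t : arith.Term (Fin n)) :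
    t.realize (fun i => HerbrandModel.mk h (hullTerm τ (σ i))) =
      HerbrandModel.mk h (hullTerm τ ((toSk t).subst σ)) := by
  induction t with
  | var i => rfl
  | func f ts ih =>
    rw [Term.realize_func]
    simp only [ih]
    exact HerbrandModel.funMap_mk h f _

/-- The contrapositive form makes universal quantifiers supply the values: a counterexample is
assigned to the variable, while Skolem terms follow by themselves. The invariant is that the values
of `σ` do not depend on variables named at or below `π`, which are still free to be chosen. -/
theorem exists_not_sat_skolem {n : ℕ} {φ : Fml n} (hφ : φ.IsNNF) :
    ∀ (σ : Fin n → arithSk.Term (List Bool)) (π : List Bool) (τ : List Bool → hull Λ),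
      (∀ i (τ τ' : List Bool → hull Λ), EqOff π τ τ' → hullTerm τ (σ i) = hullTerm τ' (σ i)) →
      ¬ φ.Realize (fun i => HerbrandModel.mk h (hullTerm τ (σ i))) →
      ∃ τ' : List Bool → hull Λ, EqOff π τ τ' ∧
        ¬ p.Sat (fun x => (τ' x : M)) (φ.skolem σ π) := by
  classical
  induction hφ with
  | eq t s =>
    intro σ π τ _ hr
    refine ⟨τ, fun _ _ => rfl, ?_⟩
    simp only [Fml.Realize, HerbrandModel.realize_mk, HerbrandModel.mk_eq_mk] at hr
    exact hr
  | le t s =>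
    intro σ π τ _ hr
    refine ⟨τ, fun _ _ => rfl, ?_⟩
    simp only [Fml.Realize, HerbrandModel.realize_mk] at hr
    exact fun hs => hr ((HerbrandModel.leM_mk h).2 hs)
  | neg_eq t s =>
    intro σ π τ _ hr
    refine ⟨τ, fun _ _ => rfl, ?_⟩
    simp only [Fml.Realize, HerbrandModel.realize_mk, HerbrandModel.mk_eq_mk] at hr
    exact hr
  | neg_le t s =>
    intro σ π τ _ hr
    refine ⟨τ, fun _ _ => rfl, ?_⟩
    simp only [Fml.Realize, HerbrandModel.realize_mk, not_not] at hr
    exact not_not.2 ((HerbrandModel.leM_mk h).1 hr)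
  | @and n φ ψ _ _ ih ih' =>
    intro σ π τ hσ hr
    rw [Fml.Realize, not_and_or] at hr
    rcases hr with hr | hr
    · obtain ⟨τ', h1, h2⟩ := ih σ (π ++ [false]) τ (fun i _ _ e => hσ i _ _ e.of_append) hr
      exact ⟨τ', h1.of_append, fun hs => h2 hs.1⟩
    · obtain ⟨τ', h1, h2⟩ := ih' σ (π ++ [true]) τ (fun i _ _ e => hσ i _ _ e.of_append) hr
      exact ⟨τ', h1.of_append, fun hs => h2 hs.2⟩
  | @or n φ ψ _ _ ih ih' =>
    intro σ π τ hσ hr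
    rw [Fml.Realize, not_or] at hr
    obtain ⟨τ₁, e₁, h₁⟩ := ih σ (π ++ [false]) τ (fun i _ _ e => hσ i _ _ e.of_append) hr.1
    obtain ⟨τ₂, e₂, h₂⟩ := ih' σ (π ++ [true]) τ (fun i _ _ e => hσ i _ _ e.of_append) hr.2
    -- Each disjunct is refuted by an assignment of its own. They can be glued because the two
    -- disjuncts introduce variables at positions with incompatible prefixes.
    let τ' : List Bool → hull Λ := fun x => if π ++ [false] <+: x then τ₁ x else τ₂ x
    have disj : ∀ x, π ++ [true] <+: x → ¬ π ++ [false] <+: x := by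
      rintro x ⟨u, rfl⟩ ⟨v, hv⟩
      simp at hv
    have e' : EqOff π τ τ' := by
      intro x hx
      have hx' : ¬ π ++ [false] <+: x := fun hh => hx ((List.prefix_append _ _).trans hh)
      simp only [τ', if_neg hx']
      exact e₂.of_append x hx
    have c₁ : ∀ i, termCode (fun x => (τ' x : M)) (σ i) = termCode (fun x => (τ₁ x : M)) (σ i) :=
      fun i => congrArg Subtype.val ((hσ i _ _ e').symm.trans (hσ i _ _ e₁.of_append))
    have c₂ : ∀ i, termCode (fun x => (τ' x : M)) (σ i) = termCode (fun x => (τ₂ x : M)) (σ i) :=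
      fun i => congrArg Subtype.val ((hσ i _ _ e').symm.trans (hσ i _ _ e₂.of_append))
    refine ⟨τ', e', ?_⟩
    rintro (hs | hs)
    · refine h₁ ((sat_skolem_congr φ σ _ _ _ c₁ fun x hx => ?_).1 hs)
      simp only [τ', if_pos hx]
    · refine h₂ ((sat_skolem_congr ψ σ _ _ _ c₂ fun x hx => ?_).1 hs)
      simp only [τ', if_neg (disj x hx)]
  | @all n φ _ ih =>
    intro σ π τ hσ hr
    rw [Fml.Realize, not_forall] at hr
    obtain ⟨a, hr⟩ := hr
    obtain ⟨t, rfl⟩ := HerbrandModel.mk_surjective h a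
    -- The counterexample `t` becomes the value of the variable named `π`, on which no value of `σ`
    -- depends.
    have e : EqOff π τ (Function.update τ π t) := fun x hx => by
      rw [Function.update_of_ne]
      rintro rfl
      exact hx (List.prefix_refl _)
    have hv : (Fin.snoc (fun i => HerbrandModel.mk h (hullTerm τ (σ i))) (HerbrandModel.mk h t) :
        Fin (n + 1) → HerbrandModel h) = fun i => HerbrandModel.mk h
          (hullTerm (Function.update τ π t) ((Fin.snoc σ (Term.var π) :
            Fin (n + 1) → arithSk.Term (List Bool)) i)) := by
      funext i
      refine Fin.lastCases ?_ (fun i => ?_) i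
      · simp [hullTerm, termCode]
      · simp only [Fin.snoc_castSucc]
        rw [hσ i _ _ e]
    rw [hv] at hr
    refine (ih _ (π ++ [false]) _ (fun i τ₁ τ₂ e₁ => ?_) hr).imp fun τ' hτ' =>
      ⟨fun x hx => (e x hx).trans (hτ'.1.of_append x hx), hτ'.2⟩
    refine Fin.lastCases ?_ (fun i => ?_) i
    · have := e₁ π fun hp => by simpa using hp.length_le
      simp [hullTerm, termCode, this]
    · simpa using hσ i _ _ e₁.of_append
  | @ex n φ _ ih =>
    intro σ π τ hσ hr
    rw [Fml.Realize, not_exists] at hr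
    -- No element is a witness, in particular not the class of the Skolem term; nothing has to be
    -- reassigned here.
    replace hr := hr (HerbrandModel.mk h (hullTerm τ
      (Term.func (skSymbol φ) fun i => σ ((Fml.ex φ).fv.orderEmbOfFin rfl i))))
    have hv : (Fin.snoc (fun i => HerbrandModel.mk h (hullTerm τ (σ i)))
        (HerbrandModel.mk h (hullTerm τ
          (Term.func (skSymbol φ) fun i => σ ((Fml.ex φ).fv.orderEmbOfFin rfl i)))) :
        Fin (n + 1) → HerbrandModel h) = fun i => HerbrandModel.mk h
          (hullTerm τ ((Fin.snoc σ
            (Term.func (skSymbol φ) fun i => σ ((Fml.ex φ).fv.orderEmbOfFin rfl i)) :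
            Fin (n + 1) → arithSk.Term (List Bool)) i)) := by
      funext i
      refine Fin.lastCases ?_ (fun i => ?_) i <;> simp
    rw [hv] at hr
    refine (ih _ (π ++ [false]) _ (fun i τ₁ τ₂ e₁ => ?_) hr).imp fun τ' hτ' =>
      ⟨hτ'.1.of_append, hτ'.2⟩
    refine Fin.lastCases ?_ (fun i => ?_) i
    · simp only [Fin.snoc_last]
      refine Subtype.ext ?_
      simp only [hullTerm, termCode]
      congr 1
      funext j
      exact congrArg Subtype.val (hσ _ _ _ e₁.of_append)
    · simpa using hσ i _ _ e₁.of_append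

/-- A Herbrand model of a `T`-evaluation is a model of `T`. -/
theorem TermValuation.IsEvaluationOf.models {T : Set (Fml 0)}
    (hT : p.IsEvaluationOf T (hull Λ)) (hne : (hull Λ).Nonempty) :
    Models (HerbrandModel hT.isEvaluation) T := by
  intro θ hθ
  by_contra hr
  obtain ⟨t₀, ht₀⟩ := hne
  -- A sentence has no arguments to interpret; the element `t₀` of the hull only provides a starting
  -- value for all variables.
  rw [← (Fml.realize_nnf θ _).1, Subsingleton.elim (Fin.elim0 : Fin 0 → _) fun i =>
    HerbrandModel.mk hT.isEvaluation (hullTerm (fun _ => ⟨t₀, ht₀⟩)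
      ((Fin.elim0 : Fin 0 → arithSk.Term (List Bool)) i))] at hr
  obtain ⟨τ, -, hs⟩ := exists_not_sat_skolem hT.isEvaluation (θ.isNNF_nnf true)
    _ [] _ (fun i => i.elim0) hr
  exact hs (hT.sat θ hθ _ fun t _ => termCode_mem_hull (fun x => (τ x).2) t)

end Herbrand

/-! ## Absoluteness of bounded formulas -/

section Absoluteness

/-- `N` embeds the initial segment `I` of `M`, which is closed under the operations, onto an initial
segment of `K`. -/
structure IsCutEmbedding {M K : Type*} [arith.Structure M] [arith.Structure K] (I : Set M)
    (N : M → K) : Prop where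
  zero_mem : zeroM ∈ I
  succ_mem : ∀ x ∈ I, succM x ∈ I
  add_mem : ∀ x ∈ I, ∀ y ∈ I, addM x y ∈ I
  mul_mem : ∀ x ∈ I, ∀ y ∈ I, mulM x y ∈ I
  mem_of_le : ∀ x ∈ I, ∀ y, leM y x → y ∈ I
  map_zero : N zeroM = zeroM
  map_succ : ∀ x ∈ I, N (succM x) = succM (N x)
  map_add : ∀ x ∈ I, ∀ y ∈ I, N (addM x y) = addM (N x) (N y)
  map_mul : ∀ x ∈ I, ∀ y ∈ I, N (mulM x y) = mulM (N x) (N y)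
  le_iff : ∀ x ∈ I, ∀ y ∈ I, leM (N x) (N y) ↔ leM x y
  eq_iff : ∀ x ∈ I, ∀ y ∈ I, N x = N y ↔ x = y
  exists_of_le : ∀ x ∈ I, ∀ c, leM c (N x) → ∃ y, leM y x ∧ N y = c

variable {M K : Type*} [arith.Structure M] [arith.Structure K] {I : Set M} {N : M → K}

theorem IsCutEmbedding.realize_term (h : IsCutEmbedding I N) {α : Type} {v : α → M}
    (hv : ∀ i, v i ∈ I) (t : arith.Term α) :
    t.realize v ∈ I ∧ t.realize (fun i => N (v i)) = N (t.realize v) := by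
  induction t using arith_term_induction with
  | var x => exact ⟨hv x, rfl⟩
  | zero => simpa using ⟨h.zero_mem, h.map_zero.symm⟩
  | succ t ih =>
    simp only [realize_tsucc, ih.2]
    exact ⟨h.succ_mem _ ih.1, (h.map_succ _ ih.1).symm⟩
  | add t s ih ih' =>
    simp only [realize_tadd, ih.2, ih'.2]
    exact ⟨h.add_mem _ ih.1 _ ih'.1, (h.map_add _ ih.1 _ ih'.1).symm⟩
  | mul t s ih ih' =>
    simp only [realize_tmul, ih.2, ih'.2]
    exact ⟨h.mul_mem _ ih.1 _ ih'.1, (h.map_mul _ ih.1 _ ih'.1).symm⟩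

theorem comp_snoc {A B : Type*} (N : A → B) {n : ℕ} (v : Fin n → A) (a : A) :
    (Fin.snoc (fun i => N (v i)) (N a) : Fin (n + 1) → B) =
      fun i => N ((Fin.snoc v a : Fin (n + 1) → A) i) := by
  funext i
  refine Fin.lastCases ?_ (fun i => ?_) i <;> simp

theorem snoc_mem {A : Type*} {S : Set A} {n : ℕ} {v : Fin n → A} {a : A} (hv : ∀ i, v i ∈ S)
    (ha : a ∈ S) (i : Fin (n + 1)) : (Fin.snoc v a : Fin (n + 1) → A) i ∈ S := by
  refine Fin.lastCases ?_ (fun i => ?_) i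
  · simpa using ha
  · simpa using hv i

/-- The bound of a quantifier takes its value in `I`. Elements of `M` below it lie in `I` by
downward closure, and elements of `K` below its image are images by `exists_of_le`, so both sides
quantify over corresponding elements. -/
theorem IsCutEmbedding.realize_iff (h : IsCutEmbedding I N) {n : ℕ} {φ : Fml n}
    (hφ : φ.IsBounded) :
    ∀ v : Fin n → M, (∀ i, v i ∈ I) → (φ.Realize v ↔ φ.Realize fun i => N (v i)) := by
  induction hφ with
  | eq t s =>
    intro v hv
    have ht := h.realize_term hv t
    have hs := h.realize_term hv s
    simp only [Fml.Realize, ht.2, hs.2]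
    exact (h.eq_iff _ ht.1 _ hs.1).symm
  | le t s =>
    intro v hv
    have ht := h.realize_term hv t
    have hs := h.realize_term hv s
    simp only [Fml.Realize, ht.2, hs.2]
    exact (h.le_iff _ ht.1 _ hs.1).symm
  | neg _ ih => intro v hv; exact not_congr (ih v hv)
  | and _ _ ih ih' => intro v hv; exact and_congr (ih v hv) (ih' v hv)
  | or _ _ ih ih' => intro v hv; exact or_congr (ih v hv) (ih' v hv)
  | imp _ _ ih ih' => intro v hv; exact imp_congr (ih v hv) (ih' v hv)
  | @ball n t φ _ ih =>
    intro v hv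
    have ht := h.realize_term hv t
    simp only [Fml.Realize, realize_lastVar, realize_liftTerm, ht.2]
    constructor
    · intro H c hc
      obtain ⟨a, ha, rfl⟩ := h.exists_of_le _ ht.1 c hc
      rw [comp_snoc]
      exact (ih _ (snoc_mem hv (h.mem_of_le _ ht.1 _ ha))).1 (H a ha)
    · intro H a ha
      have haI := h.mem_of_le _ ht.1 _ ha
      refine (ih _ (snoc_mem hv haI)).2 ?_
      rw [← comp_snoc]
      exact H _ ((h.le_iff _ haI _ ht.1).2 ha)
  | @bex n t φ _ ih =>
    intro v hv
    have ht := h.realize_term hv t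
    simp only [Fml.Realize, realize_lastVar, realize_liftTerm, ht.2]
    constructor
    · rintro ⟨a, ha, H⟩
      have haI := h.mem_of_le _ ht.1 _ ha
      refine ⟨N a, (h.le_iff _ haI _ ht.1).2 ha, ?_⟩
      rw [comp_snoc]
      exact (ih _ (snoc_mem hv haI)).1 H
    · rintro ⟨c, hc, H⟩
      obtain ⟨a, ha, rfl⟩ := h.exists_of_le _ ht.1 c hc
      refine ⟨a, ha, (ih _ (snoc_mem hv (h.mem_of_le _ ht.1 _ ha))).2 ?_⟩
      rwa [← comp_snoc]

end Absoluteness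

/-! ## Numerals in Herbrand models -/

section Numerals

variable {M : Type*} [arith.Structure M]

theorem HerbrandModel.zeroM_eq {p : TermValuation M} {Λ : Set M} (h : p.IsEvaluation (hull Λ))
    {u : hull Λ} (hu : (u : M) = app (baseSymbol .zero) ![]) :
    HerbrandModel.mk h u = zeroM := by
  refine Eq.trans ?_ ((HerbrandModel.funMap_mk h .zero ![]).symm.trans
    (congrArg (Structure.funMap (L := arith) ArithFunc.zero) (Subsingleton.elim _ _)))
  congr 1
  refine Subtype.ext (hu.trans ?_)
  congr 1
  exact Subsingleton.elim _ _

theorem HerbrandModel.succM_mk {p : TermValuation M} {Λ : Set M} (h : p.IsEvaluation (hull Λ))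
    {t u : hull Λ} (hu : (u : M) = app (baseSymbol .succ) ![(t : M)]) :
    HerbrandModel.mk h u = succM (HerbrandModel.mk h t) := by
  refine Eq.trans ?_ ((HerbrandModel.funMap_mk h .succ ![t]).symm.trans
    (congrArg (Structure.funMap (L := arith) ArithFunc.succ) ?_))
  · congr 1
    refine Subtype.ext (hu.trans ?_)
    congr 1
    funext i
    fin_cases i; rfl
  · funext i
    fin_cases i; rfl

/-- Turns an equation in the Herbrand model, an object outside `M`, into a statement about codes and
`p` to which induction in `M` applies. -/
theorem HerbrandModel.addM_mk_eq_iff {p : TermValuation M} {Λ : Set M}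
    (h : p.IsEvaluation (hull Λ)) (t s u : hull Λ) :
    addM (HerbrandModel.mk h t) (HerbrandModel.mk h s) = HerbrandModel.mk h u ↔
      p.eq (app (baseSymbol .add) ![(t : M), (s : M)]) u := by
  have e : (fun i => ((![t, s] : Fin 2 → hull Λ) i : M)) = ![(t : M), (s : M)] := by
    funext i
    fin_cases i <;> rfl
  have e' : (fun i => HerbrandModel.mk h ((![t, s] : Fin 2 → hull Λ) i)) =
      ![HerbrandModel.mk h t, HerbrandModel.mk h s] := by
    funext i
    fin_cases i <;> rfl
  rw [addM, ← e', HerbrandModel.funMap_mk h .add ![t, s], HerbrandModel.mk_eq_mk]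
  exact iff_of_eq (congrArg (fun a => p.eq (app (baseSymbol .add) a) u) e)

theorem HerbrandModel.mulM_mk_eq_iff {p : TermValuation M} {Λ : Set M}
    (h : p.IsEvaluation (hull Λ)) (t s u : hull Λ) :
    mulM (HerbrandModel.mk h t) (HerbrandModel.mk h s) = HerbrandModel.mk h u ↔
      p.eq (app (baseSymbol .mul) ![(t : M), (s : M)]) u := by
  have e : (fun i => ((![t, s] : Fin 2 → hull Λ) i : M)) = ![(t : M), (s : M)] := by
    funext i
    fin_cases i <;> rfl
  have e' : (fun i => HerbrandModel.mk h ((![t, s] : Fin 2 → hull Λ) i)) =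
      ![HerbrandModel.mk h t, HerbrandModel.mk h s] := by
    funext i
    fin_cases i <;> rfl
  rw [mulM, ← e', HerbrandModel.funMap_mk h .mul ![t, s], HerbrandModel.mk_eq_mk]
  exact iff_of_eq (congrArg (fun a => p.eq (app (baseSymbol .mul) a) u) e)

/-- `app` unfolds to two concatenations starting from the fixed code of the symbol. -/
theorem BddFn.app₂ (hM : Models M IDelta0) {n : ℕ} (g : ArithFunc 2) {f f' : (Fin n → M) → M}
    (hf : BddFn f) (hf' : BddFn f') : BddFn fun v => app (baseSymbol g) ![f v, f' v] :=
  BddFn.conc hM (BddFn.conc hM ((PolyFn.const (baseCode g)).bddFn hM) hf) hf'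

/-- The numbers below some standard power of `α`. -/
def powerCut (α : M) : Set M := {x | ∃ k : ℕ, leM x (powM α k)}

/-- If the numerals up to `ω` are given by a definable function, their classes embed every cut below
`ω` onto an initial segment of the Herbrand model. -/
theorem isCutEmbedding_numerals (hM : Models M IDelta0) {ω : M} {Λ : Set M} {p : TermValuation M}
    (hp : p.Internal) (h : p.IsEvaluation (hull Λ)) (hK : Models (HerbrandModel h) IDelta0)
    {F : M → M} (hF : BddFn fun v : Fin 1 → M => F (v 0))
    (hF0 : F zeroM = app (baseSymbol .zero) ![])
    (hFs : ∀ i, leM (succM i) ω → F (succM i) = app (baseSymbol .succ) ![F i])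
    {T : M → hull Λ} (hT : ∀ j, leM j ω → (T j : M) = F j) {I : Set M}
    (hIω : ∀ x ∈ I, leM x ω) (zero_mem : zeroM ∈ I) (succ_mem : ∀ x ∈ I, succM x ∈ I)
    (add_mem : ∀ x ∈ I, ∀ y ∈ I, addM x y ∈ I) (mul_mem : ∀ x ∈ I, ∀ y ∈ I, mulM x y ∈ I)
    (mem_of_le : ∀ x ∈ I, ∀ y, leM y x → y ∈ I) :
    IsCutEmbedding I fun j => HerbrandModel.mk h (T j) := by
  have peq : BddDef fun v : Fin 2 → M => p.eq (v 0) (v 1) := hp.1.bddDef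
  have ple : BddDef fun v : Fin 2 → M => p.le (v 0) (v 1) := hp.2.bddDef
  have le_succ : ∀ x : M, leM x (succM x) := fun x =>
    hM.le_iff.2 ⟨succM zeroM, by rw [hM.add_succ, hM.add_zero]⟩
  have le_add : ∀ x y : M, leM x (addM x y) := fun x y => hM.le_iff.2 ⟨y, rfl⟩
  have le_add' : ∀ x y : M, leM y (addM x y) := fun x y => hM.le_iff.2 ⟨x, hM.add_comm y x⟩
  have zle : ∀ x : M, leM zeroM x := fun x => hM.le_iff.2 ⟨x, hM.zero_add x⟩
  have map_zero : HerbrandModel.mk h (T zeroM) = zeroM :=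
    HerbrandModel.zeroM_eq h ((hT _ (zle _)).trans hF0)
  have map_succ : ∀ x, leM (succM x) ω →
      HerbrandModel.mk h (T (succM x)) = succM (HerbrandModel.mk h (T x)) := fun x hx =>
    HerbrandModel.succM_mk h (by
      rw [hT _ hx, hFs _ hx, hT _ (hM.le_trans (le_succ x) hx)])
  have map_add : ∀ x y, leM (addM x y) ω → addM (HerbrandModel.mk h (T x))
      (HerbrandModel.mk h (T y)) = HerbrandModel.mk h (T (addM x y)) := by
    intro x y hxy
    have key : ∀ y, leM (addM x y) ω → (addM (HerbrandModel.mk h (T x))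
        (HerbrandModel.mk h (T y)) = HerbrandModel.mk h (T (addM x y)) ↔
        p.eq (app (baseSymbol .add) ![F x, F y]) (F (addM x y))) := fun y hy => by
      rw [HerbrandModel.addM_mk_eq_iff, hT _ hy, hT _ (hM.le_trans (le_add _ _) hy),
        hT _ (hM.le_trans (le_add' _ _) hy)]
    -- The induction runs in `M` on the translated statement; each step goes back through `key` and
    -- uses the recursion for `+` in both models.
    refine (key y hxy).2 (hM.induction (P := fun y => leM (addM x y) ω →
      p.eq (app (baseSymbol .add) ![F x, F y]) (F (addM x y))) ?_ (fun h0 => ?_)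
      (fun y ih hy => ?_) y hxy)
    · have hxy : PolyFn fun v : Fin 1 → M => addM x (v 0) := (PolyFn.const x).add (.var 0)
      exact (hxy.le (.const _)).imp (BddDef.comp₂ peq
        (BddFn.app₂ hM .add ((PolyFn.const (F x)).bddFn hM) hF)
        (BddFn.comp₁ hM hF (hxy.bddFn hM)))
    · rw [← key _ h0, map_zero, hK.add_zero, hM.add_zero]
    · have hy' := hy
      rw [hM.add_succ] at hy'
      have ih' := (key y (hM.le_trans (le_succ _) hy')).2 (ih (hM.le_trans (le_succ _) hy'))
      rw [← key _ hy, hM.add_succ, map_succ _ hy', map_succ y (hM.le_trans (le_add' _ _) hy),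
        hK.add_succ, ih']
  have map_mul : ∀ x ∈ I, ∀ y ∈ I, mulM (HerbrandModel.mk h (T x))
      (HerbrandModel.mk h (T y)) = HerbrandModel.mk h (T (mulM x y)) := by
    intro x hx y hy
    have hyω := hIω y hy
    have hxy := hIω _ (mul_mem x hx y hy)
    -- The bound on `y` is separate, since `x y ≤ ω` does not imply `y ≤ ω` when `x = 0`.
    have key : ∀ y, leM y ω → leM (mulM x y) ω → (mulM (HerbrandModel.mk h (T x))
        (HerbrandModel.mk h (T y)) = HerbrandModel.mk h (T (mulM x y)) ↔
        p.eq (app (baseSymbol .mul) ![F x, F y]) (F (mulM x y))) := fun y hy hxy => by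
      rw [HerbrandModel.mulM_mk_eq_iff, hT _ hxy, hT _ (hIω x hx), hT _ hy]
    refine (key y hyω hxy).2 (hM.induction (P := fun y => leM y ω → leM (mulM x y) ω →
      p.eq (app (baseSymbol .mul) ![F x, F y]) (F (mulM x y))) ?_ (fun h0 h0' => ?_)
      (fun y ih hy hxy => ?_) y hyω hxy)
    · have hxy : PolyFn fun v : Fin 1 → M => mulM x (v 0) := (PolyFn.const x).mul (.var 0)
      exact ((PolyFn.var 0).le (.const _)).imp ((hxy.le (.const _)).imp (BddDef.comp₂ peq
        (BddFn.app₂ hM .mul ((PolyFn.const (F x)).bddFn hM) hF)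
        (BddFn.comp₁ hM hF (hxy.bddFn hM))))
    · rw [← key _ h0 h0', map_zero, hK.mul_zero, hM.mul_zero, map_zero]
    · have hxy' := hxy
      rw [hM.mul_succ] at hxy'
      have hy' := hM.le_trans (le_succ y) hy
      have hm := hM.le_trans (le_add _ _) hxy'
      have ih' := (key y hy' hm).2 (ih hy' hm)
      rw [← key _ hy hxy, hM.mul_succ, map_succ _ hy, hK.mul_succ, ih', map_add _ _ hxy']
  have mono : ∀ x y, leM x y → leM y ω →
      leM (HerbrandModel.mk h (T x)) (HerbrandModel.mk h (T y)) := by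
    intro x y hxy hy
    obtain ⟨z, rfl⟩ := hM.le_iff.1 hxy
    exact hK.le_iff.2 ⟨_, map_add x z hy⟩
  have not_succ_le : ∀ c : HerbrandModel h, ¬ leM (succM c) c := fun c hc =>
    let _ := hK.linearOrder
    lt_irrefl c (hK.lt_succ_iff.2 hc)
  -- Otherwise `y + 1 ≤ x`, and by monotonicity the class of `y̲` would bound its own successor.
  have reflect : ∀ x y, leM x ω → leM y ω →
      leM (HerbrandModel.mk h (T x)) (HerbrandModel.mk h (T y)) → leM x y := by
    intro x y hx hy hxy
    let _ := hM.linearOrder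
    by_contra hn
    have hlt : leM (succM y) x := hM.lt_succ_iff.1 (lt_of_not_ge (α := M) hn)
    have := mono _ _ hlt hx
    rw [map_succ _ (hM.le_trans hlt hx)] at this
    exact not_succ_le _ (hK.le_trans this hxy)
  refine ⟨zero_mem, succ_mem, add_mem, mul_mem, mem_of_le, map_zero,
    fun x hx => map_succ x (hIω _ (succ_mem x hx)),
    fun x hx y hy => (map_add x y (hIω _ (add_mem x hx y hy))).symm,
    fun x hx y hy => (map_mul x hx y hy).symm,
    fun x hx y hy => ⟨reflect x y (hIω x hx) (hIω y hy), fun hxy => mono x y hxy (hIω y hy)⟩,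
    fun x hx y hy => ⟨fun e => hM.le_antisymm (reflect x y (hIω x hx) (hIω y hy) ?_)
      (reflect y x (hIω y hy) (hIω x hx) ?_), fun e => e ▸ rfl⟩, fun a ha c hc => ?_⟩
  · rw [e]; exact hK.le_refl _
  · rw [e]; exact hK.le_refl _
  · obtain ⟨t, rfl⟩ := HerbrandModel.mk_surjective h c
    by_contra hn
    push Not at hn
    have haω := hIω a ha
    -- Since `c` is the class of a single code `t`, the claim has a bounded definition with
    -- parameter `t`. In the step, `j̲ ≤ c` and `j̲ ≠ c` give that the successor of `j̲` is still at
    -- most `c`.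
    have key : ∀ j, leM j a → p.le (F j) t := by
      refine hM.induction (P := fun j => leM j a → p.le (F j) t) ?_ (fun h0 => ?_)
        (fun j ih hj => ?_)
      · exact ((PolyFn.var 0).le (.const _)).imp
          (BddDef.comp₂ ple hF ((PolyFn.const (t : M)).bddFn hM))
      · rw [← hT _ (zle _), ← HerbrandModel.leM_mk h, map_zero]
        exact hK.le_iff.2 ⟨_, hK.zero_add _⟩
      · have hj' := hM.le_trans (le_succ j) hj
        have hjω := hM.le_trans hj haω
        have h1 := ih hj'
        rw [← hT _ (hM.le_trans hj' haω), ← HerbrandModel.leM_mk h] at h1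
        rw [← hT _ hjω, ← HerbrandModel.leM_mk h, map_succ _ hjω]
        let _ := hK.linearOrder
        exact hK.lt_succ_iff.1 (lt_of_le_of_ne h1 (hn j hj'))
    have h1 := key a (hM.le_refl a)
    rw [← hT _ haω, ← HerbrandModel.leM_mk h] at h1
    exact hn a (hM.le_refl a) (hK.le_antisymm h1 hc)

end Numerals

/-! ## The cut of powers of a nonstandard element -/

section PowerCut

variable {M : Type*} [arith.Structure M] {α : M}

theorem powerCut_mem_of_le (hM : Models M IDelta0) (x : M) (hx : x ∈ powerCut α) (y : M)
    (hy : leM y x) : y ∈ powerCut α :=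
  hx.imp fun _ h => hM.le_trans hy h

theorem two_le_of_nonstandard (hM : Models M IDelta0) (hα : ∀ n : ℕ, α ≠ stdM n) :
    leM (stdM 2) α :=
  (hM.le_total _ _).resolve_right fun h =>
    let ⟨m, hm⟩ := hM.eq_std_of_le h
    hα m hm

theorem powerCut_closed (hM : Models M IDelta0) (hα : ∀ n : ℕ, α ≠ stdM n) :
    zeroM ∈ powerCut α ∧ (∀ x ∈ powerCut α, succM x ∈ powerCut α) ∧
      (∀ x ∈ powerCut α, ∀ y ∈ powerCut α, addM x y ∈ powerCut α) ∧
      ∀ x ∈ powerCut α, ∀ y ∈ powerCut α, mulM x y ∈ powerCut α := by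
  let _ := hM.commSemiring
  let _ := hM.linearOrder
  have := hM.isStrictOrderedRing
  have := hM.canonicallyOrderedAdd
  have h2 : (2 : M) ≤ α := by
    have h : ((2 : ℕ) : M) ≤ α := two_le_of_nonstandard hM hα
    exact_mod_cast h
  have h1 : (1 : M) ≤ α := le_trans one_le_two h2
  have mem_iff : ∀ x : M, x ∈ powerCut α ↔ ∃ k : ℕ, x ≤ α ^ k := fun x =>
    exists_congr fun k => by rw [hM.powM_eq]; rfl
  have hone : succM zeroM ∈ powerCut α :=
    (mem_iff _).2 ⟨0, by rw [pow_zero]; exact le_refl (1 : M)⟩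
  have hadd : ∀ x ∈ powerCut α, ∀ y ∈ powerCut α, addM x y ∈ powerCut α := by
    intro x hx y hy
    obtain ⟨k, hk⟩ := (mem_iff x).1 hx
    obtain ⟨l, hl⟩ := (mem_iff y).1 hy
    -- Both summands are at most `α ^ (k + l)`; one more factor `α ≥ 2` absorbs the doubling.
    refine (mem_iff _).2 ⟨k + l + 1, ?_⟩
    have hk' : x ≤ α ^ (k + l) := hk.trans (pow_le_pow_right₀ h1 (by omega))
    have hl' : y ≤ α ^ (k + l) := hl.trans (pow_le_pow_right₀ h1 (by omega))
    calc x + y ≤ α ^ (k + l) + α ^ (k + l) := add_le_add hk' hl'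
      _ = α ^ (k + l) * 2 := (mul_two _).symm
      _ ≤ α ^ (k + l) * α := mul_le_mul' le_rfl h2
      _ = α ^ (k + l + 1) := (pow_succ _ _).symm
  refine ⟨(mem_iff _).2 ⟨0, zero_le (a := α ^ 0)⟩, fun x hx => ?_, hadd, fun x hx y hy => ?_⟩
  · rw [hM.succ_eq_add_one]
    exact hadd x hx _ hone
  · obtain ⟨k, hk⟩ := (mem_iff x).1 hx
    obtain ⟨l, hl⟩ := (mem_iff y).1 hy
    exact (mem_iff _).2 ⟨k + l, by rw [pow_add]; exact mul_le_mul' hk hl⟩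

end PowerCut

end HerbrandArith

/-! ### Transfer of bounded truth to the Herbrand model -/

theorem theorem3p12 {M : Type*} [arith.Structure M] (hM : Models M IDelta0)
    (α ω : M) (hα : ∀ n : ℕ, α ≠ stdM n) (hω : IsOmega1 α ω)
    (Λ : Set M) (hΛ : ∀ t ∈ Λ, IsTerm t)
    (hnum : ∀ j : M, leM j ω → ∃ t ∈ Λ, IsNumeral j t)
    (p : TermValuation M) (hp : p.Internal) (hpT : p.IsEvaluationOf IDelta0 (hull Λ))
    {m : ℕ} (φ : Fml m) (hφ : φ.IsBounded)
    (k : ℕ) (i : Fin m → M) (hi : ∀ l, leM (i l) (powM α k))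
    (htrue : φ.Realize i) :
    (∀ l, ∃ t ∈ Λ, IsNumeral (i l) t) ∧
      ∀ t : Fin m → hull Λ, (∀ l, IsNumeral (i l) (t l : M)) →
        φ.Realize fun l => HerbrandModel.mk hpT.isEvaluation (t l) := by
  have hiω : ∀ l, leM (i l) ω := fun l => hM.le_trans (hi l) (hM.pow_le_omega1 hα hω k)
  refine ⟨fun l => hnum _ (hiω l), fun t ht => ?_⟩
  -- The sequence witnessing the numeral of `ω` contains all smaller numerals, so one definable `F`
  -- describes them all.
  obtain ⟨t₀, ht₀, hn⟩ := hnum ω (hM.le_refl ω)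
  have subset_hull : ∀ x ∈ Λ, x ∈ hull Λ := fun x hx => Set.mem_iUnion.2 ⟨0, hx⟩
  obtain ⟨F, hF, hF0, hFs, -⟩ := IsIterate.exists_bddFn hn hM
  have numeral_eq : ∀ j x, leM j ω → IsNumeral j x → x = F j := by
    intro j x hj hx
    obtain ⟨G, hG, hG0, hGs, rfl⟩ := IsIterate.exists_bddFn hx hM
    exact iterate_unique hM (g := fun t => app (baseSymbol .succ) ![t]) hG hF
      (hG0.trans hF0.symm) hGs hFs j (hM.le_refl j) hj
  -- Above `ω` the numeral need not exist; `t₀` is a default value there.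
  have hT : ∀ j, ∃ u : hull Λ, leM j ω → (u : M) = F j := by
    intro j
    by_cases hj : leM j ω
    · obtain ⟨x, hx, hjx⟩ := hnum j hj
      exact ⟨⟨x, subset_hull x hx⟩, fun _ => numeral_eq j x hj hjx⟩
    · exact ⟨⟨t₀, subset_hull _ ht₀⟩, fun h => absurd h hj⟩
  choose T hT using hT
  have hK := hpT.models ⟨t₀, subset_hull _ ht₀⟩
  obtain ⟨c0, cs, ca, cm⟩ := powerCut_closed hM hα
  have hN := isCutEmbedding_numerals hM hp hpT.isEvaluation hK hF hF0 hFs hT (I := powerCut α)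
    (fun x ⟨k, hk⟩ => hM.le_trans hk (hM.pow_le_omega1 hα hω k)) c0 cs ca cm
    (powerCut_mem_of_le hM)
  have htT : t = fun l => T (i l) := funext fun l =>
    Subtype.ext ((numeral_eq _ _ (hiω l) (ht l)).trans (hT _ (hiω l)).symm)
  rw [htT]
  exact (hN.realize_iff hφ i fun l => ⟨k, hi l⟩).1 htrue
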